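/- Let $n\ge 1$, let $0<s<1$, and let $\Omega\subset\mathbb R^n$ be a bounded open set with Lipschitz continuous boundary. Put $$C_{n,s}=\frac{s\,2^{2s}\,\Gamma\!\left(\frac{2s+n}{2}\right)}{\pi^{n/2}\,\Gamma(1-s)},$$ let $W^{s,2}_\Omega$ be the space of all measurable $u:\mathbb R^n\to\mathbb R$ with $$\int_\Omega |u|^2\,dx+\iint_{\mathbb R^{2n}\setminus(\mathbb R^n\setminus\Omega)^2}\frac{|u(x)-u(y)|^2}{|x-y|^{n+2s}}\,dx\,dy<\infty ,$$ and for $u,v\in W^{s,2}_\Omega$ let $$\mathcal E(u,v)=\frac{C_{n,s}}2\int_\Omega\int_\Omega\frac{(u(x)-u(y))(v(x)-v(y))}{|x-y|^{n+2s}}\,dy\,dx+C_{n,s}\int_\Omega\int_{\mathbb R^n\setminus\Omega}\frac{(u(x)-u(y))(v(x)-v(y))}{|x-y|^{n+2s}}\,dy\,dx .$$ For $x\in\mathbb R^n\setminus\overline\Omega$ let $\mathcal N^su(x)=C_{n,s}\int_\Omega\frac{u(x)-u(y)}{|x-y|^{n+2s}}\,dy$. Given $f\in L^2(\Omega)$,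 a function $u\in W^{s,2}_\Omega$ is called a weak solution of the Neumann problem $$(-\Delta)^su=f\ \text{ in }\Omega,\qquad \mathcal N^su=0\ \text{ in }\mathbb R^n\setminus\overline\Omega \tag{NP}$$ if $\mathcal E(u,v)=\int_\Omega fv\,dx$ for every $v\in W^{s,2}_\Omega$. For $u\in L^2(\Omega)$ let $u_N$ be the extension of $u$ to $\mathbb R^n$ (defined up to the null set $\partial\Omega$) given by $u_N=u$ in $\Omega$ and $$u_N(x)=\frac1{\rho(x)}\int_\Omega\frac{u(y)}{|x-y|^{n+2s}}\,dy,\qquad \rho(x)=\int_\Omega\frac{dy}{|x-y|^{n+2s}},\qquad x\in\mathbb R^n\setminus\overline\Omega .$$ Let $D(\mathfrak a_N)=\{u\in L^2(\Omega):u_N\in W^{s,2}_\Omega\}$ and $\mathfrak a_N(u,v)=\mathcal E(u_N,v_N)$ for $u,v\in D(\mathfrak a_N)$. Then: 1. $D(\mathfrak a_N)$ is a dense linear subspace of $L^2(\Omega)$, and $\mathfrak a_N$ is a bilinear, symmetric, non-negative and closed form on it. (Closed means: for every $\lambda>0$, each sequence in $D(\mathfrak a_N)$ that is Cauchy with respect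 to $\mathfrak a_N(u,u)+\lambda\|u\|^2_{L^2(\Omega)}$ converges with respect to it to an element of $D(\mathfrak a_N)$.) 2. There is exactly one operator $A_N$ on $L^2(\Omega)$ associated with $\mathfrak a_N$, that is, with domain the set of all $u\in D(\mathfrak a_N)$ for which there is $f\in L^2(\Omega)$ with $\mathfrak a_N(u,v)=\int_\Omega fv\,dx$ for all $v\in D(\mathfrak a_N)$, and with $A_Nu=f$. It is selfadjoint. 3. $D(A_N)$ is the set of all $u\in L^2(\Omega)$ such that $u_N\in W^{s,2}_\Omega$ and $u_N$ is a weak solution of (NP) for some right-hand side $f\in L^2(\Omega)$; and for $u\in D(A_N)$ and $f\in L^2(\Omega)$ one has $A_Nu=f$ if and only if $u_N$ is a weak solution of (NP) with right-hand side $f$. 4. The exterior condition holds: for every $u\in D(\mathfrak a_N)$ and every $x\in\mathbb R^n\setminus\overline\Omega$ the integral defining $\mathcal N^su_N(x)$ converges absolutely, and $\mathcal N^su_N(x)=0$. -/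

import Mathlib

open MeasureTheory Filter Topology

noncomputable section

/-! ### Bilinear forms and their associated operators on a real Hilbert space

A form is given by its domain `D` and by a function `a` of two variables of which only the
values on `D × D` matter. -/

section Forms

variable {H : Type*} [NormedAddCommGroup H] [InnerProductSpace ℝ H]

/-- `D` is a linear subspace and `a : D × D → ℝ` is bilinear. -/
structure IsBilinearFormOn (D : Set H) (a : H → H → ℝ) : Prop where
  zero_mem : (0 : H) ∈ D
  add_mem : ∀ u ∈ D, ∀ v ∈ D, u + v ∈ D
  smul_mem : ∀ (c : ℝ), ∀ u ∈ D, c • u ∈ D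
  add_left : ∀ u ∈ D, ∀ v ∈ D, ∀ w ∈ D, a (u + v) w = a u w + a v w
  smul_left : ∀ (c : ℝ), ∀ u ∈ D, ∀ w ∈ D, a (c • u) w = c * a u w
  add_right : ∀ u ∈ D, ∀ v ∈ D, ∀ w ∈ D, a w (u + v) = a w u + a w v
  smul_right : ∀ (c : ℝ), ∀ u ∈ D, ∀ w ∈ D, a w (c • u) = c * a w u

/-- The form `a` is symmetric on `D`. -/
def IsSymmetricFormOn (D : Set H) (a : H → H → ℝ) : Prop :=
  ∀ u ∈ D, ∀ v ∈ D, a u v = a v u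

/-- The form `a` is non-negative on `D`. -/
def IsNonnegFormOn (D : Set H) (a : H → H → ℝ) : Prop :=
  ∀ u ∈ D, 0 ≤ a u u

/-- The shifted form `a_lam(u,v) = a(u,v) + lam (u,v)`. -/
def shiftedForm (a : H → H → ℝ) (lam : ℝ) (u v : H) : ℝ :=
  a u v + lam * inner ℝ u v

/-- The form `(a, D)` is closed: for every `lam > 0`, every sequence in `D` which is Cauchy for
`a_lam` converges with respect to `a_lam` to an element of `D`. -/
def IsClosedFormOn (D : Set H) (a : H → H → ℝ) : Prop :=
  ∀ lam : ℝ, 0 < lam → ∀ u : ℕ → H, (∀ k, u k ∈ D) →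
    Tendsto (fun p : ℕ × ℕ => shiftedForm a lam (u p.1 - u p.2) (u p.1 - u p.2)) atTop (𝓝 0) →
    ∃ w ∈ D, Tendsto (fun k => shiftedForm a lam (u k - w) (u k - w)) atTop (𝓝 0)

/-- `A` is the operator associated with the form `(a, D)`: its domain is the set of all `u ∈ D`
for which there is `f ∈ H` with `a(u,v) = (f,v)` for all `v ∈ D`, and then `A u = f`. -/
def IsAssociatedOperator (D : Set H) (a : H → H → ℝ) (A : H →ₗ.[ℝ] H) : Prop :=
  (∀ u : H, u ∈ A.domain ↔ u ∈ D ∧ ∃ f : H, ∀ v ∈ D, a u v = inner ℝ f v) ∧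
  (∀ (u : A.domain) (f : H), A u = f ↔ ∀ v ∈ D, a u v = inner ℝ f v)

end Forms

/-! ### The fractional Neumann problem -/

/-- `Ω` has a Lipschitz continuous boundary: near every boundary point `Ω` is, after a rotation,
the region lying strictly above the graph of a Lipschitz function. Here `e` is the unit vector of
the vertical direction and `x - ⟪e, x⟫ e` is the horizontal part of `x`; the function `γ` is only
evaluated on the hyperplane orthogonal to `e`. -/
def HasLipschitzBoundary {n : ℕ} (Ω : Set (EuclideanSpace ℝ (Fin n))) : Prop :=
  ∀ z ∈ frontier Ω, ∃ (r : ℝ) (e : EuclideanSpace ℝ (Fin n)) (K : NNReal)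
    (γ : EuclideanSpace ℝ (Fin n) → ℝ),
    0 < r ∧ ‖e‖ = 1 ∧ LipschitzWith K γ ∧
    ∀ x ∈ Metric.ball z r, (x ∈ Ω ↔ γ (x - inner ℝ e x • e) < inner ℝ e x)

/-- The normalization constant `C_{n,s}` of the fractional Laplacian. -/
def fracConst (n : ℕ) (s : ℝ) : ℝ :=
  s * (2 : ℝ) ^ (2 * s) * Real.Gamma ((2 * s + n) / 2) /
    (Real.pi ^ ((n : ℝ) / 2) * Real.Gamma (1 - s))

/-- The power `|x - y|^(n+2s)`. -/
def distPow {n : ℕ} (s : ℝ) (x y : EuclideanSpace ℝ (Fin n)) : ℝ :=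
  ‖x - y‖ ^ ((n : ℝ) + 2 * s)

/-- The square of the norm of `W^{s,2}_Ω`, with values in `[0, ∞]`:
the integral of `|u|²` over `Ω` plus the integral of `|u(x) - u(y)|² / |x - y|^(n+2s)` over
`ℝ^{2n} ∖ (ℝⁿ ∖ Ω)²`. -/
def sobolevNormSq {n : ℕ} (s : ℝ) (Ω : Set (EuclideanSpace ℝ (Fin n)))
    (u : EuclideanSpace ℝ (Fin n) → ℝ) : ENNReal :=
  (∫⁻ x in Ω, ENNReal.ofReal (u x ^ 2)) +
    ∫⁻ p in (Ωᶜ ×ˢ Ωᶜ)ᶜ, ENNReal.ofReal ((u p.1 - u p.2) ^ 2 / distPow s p.1 p.2)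

/-- The space `W^{s,2}_Ω` of (Lebesgue) measurable functions `u : ℝⁿ → ℝ` of finite norm. -/
def sobolevSpace {n : ℕ} (s : ℝ) (Ω : Set (EuclideanSpace ℝ (Fin n))) :
    Set (EuclideanSpace ℝ (Fin n) → ℝ) :=
  {u | AEMeasurable u ∧ sobolevNormSq s Ω u < ⊤}

/-- The form `ℰ(u,v)`; for `u, v ∈ W^{s,2}_Ω` the integrals converge absolutely. -/
def energy {n : ℕ} (s : ℝ) (Ω : Set (EuclideanSpace ℝ (Fin n)))
    (u v : EuclideanSpace ℝ (Fin n) → ℝ) : ℝ :=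
  fracConst n s / 2 * (∫ x in Ω, ∫ y in Ω, (u x - u y) * (v x - v y) / distPow s x y) +
    fracConst n s * (∫ x in Ω, ∫ y in Ωᶜ, (u x - u y) * (v x - v y) / distPow s x y)

/-- The nonlocal normal derivative `𝒩^s u(x)`, for `x` outside of the closure of `Ω`. -/
def nonlocalNormalDeriv {n : ℕ} (s : ℝ) (Ω : Set (EuclideanSpace ℝ (Fin n)))
    (u : EuclideanSpace ℝ (Fin n) → ℝ) (x : EuclideanSpace ℝ (Fin n)) : ℝ :=
  fracConst n s * ∫ y in Ω, (u x - u y) / distPow s x y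

/-- `L²(Ω)`. -/
abbrev L2 {n : ℕ} (Ω : Set (EuclideanSpace ℝ (Fin n))) : Type :=
  Lp ℝ 2 (volume.restrict Ω)

/-- `u ∈ W^{s,2}_Ω` is a weak solution of the Neumann problem
`(-Δ)^s u = f` in `Ω`, `𝒩^s u = 0` in `ℝⁿ ∖ closure Ω`. -/
def IsWeakNeumannSolution {n : ℕ} (s : ℝ) (Ω : Set (EuclideanSpace ℝ (Fin n)))
    (f : L2 Ω) (u : EuclideanSpace ℝ (Fin n) → ℝ) : Prop :=
  u ∈ sobolevSpace s Ω ∧ ∀ v ∈ sobolevSpace s Ω, energy s Ω u v = ∫ x in Ω, f x * v x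

/-- The function `ρ(x) = ∫_Ω |x - y|^{-(n+2s)} dy`. -/
def rhoFun {n : ℕ} (s : ℝ) (Ω : Set (EuclideanSpace ℝ (Fin n)))
    (x : EuclideanSpace ℝ (Fin n)) : ℝ :=
  ∫ y in Ω, 1 / distPow s x y

open Classical in
/-- The Neumann extension `u_N` of `u ∈ L²(Ω)`. On the boundary of `Ω`, a null set for the sets
considered here, the value is irrelevant and put equal to `0`. -/
def neumannExt {n : ℕ} (s : ℝ) (Ω : Set (EuclideanSpace ℝ (Fin n))) (u : L2 Ω)
    (x : EuclideanSpace ℝ (Fin n)) : ℝ :=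
  if x ∈ Ω then u x
  else if x ∈ (closure Ω)ᶜ then 1 / rhoFun s Ω x * ∫ y in Ω, u y / distPow s x y
  else 0

/-- The domain `D(𝔞_N)`. -/
def neumannFormDomain {n : ℕ} (s : ℝ) (Ω : Set (EuclideanSpace ℝ (Fin n))) : Set (L2 Ω) :=
  {u | neumannExt s Ω u ∈ sobolevSpace s Ω}

/-- The form `𝔞_N(u,v) = ℰ(u_N, v_N)`. -/
def neumannForm {n : ℕ} (s : ℝ) (Ω : Set (EuclideanSpace ℝ (Fin n))) (u v : L2 Ω) : ℝ :=
  energy s Ω (neumannExt s Ω u) (neumannExt s Ω v)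

end

/-! The abstract half is the representation theorem for closed forms. Closedness makes the form
domain a Hilbert space under `a(u,v) + (u,v)`, so Riesz solves `A u + u = f` for every `f`
(`exists_resolvent`). A symmetric non-negative operator with `A + 1` onto is densely defined and
selfadjoint.

The concrete half rests on one fact: for `x` outside the closure, `u_N(x)` is the mean of `u` over
`Ω` with weight `|x - y|^{-(n+2s)}`. The mean has zero weighted deviation, which is the exterior
condition; by Fubini, `u_N` is then `ℰ`-orthogonal to every function of `W^{s,2}_Ω` vanishing in `Ω`
(`energy_neumannExt_eq_zero`). The mean also minimizes the weighted quadratic deviation, so `u_N`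
has the least energy among the extensions of `u` (`neumannExt_mem_sobolevSpace`). Orthogonality
makes testing against all of `W^{s,2}_Ω` equivalent to testing against the `v_N`; minimality gives
density, since smooth compactly supported functions have finite energy. Closedness is Fatou's lemma
(`gagliardo_le_of_tendsto`). -/

noncomputable section

/-! ### Closed symmetric forms and their selfadjoint operators -/

section Forms

variable {H : Type*} [NormedAddCommGroup H] [InnerProductSpace ℝ H]

namespace IsBilinearFormOn

variable {D : Set H} {a : H → H → ℝ}

/-- The domain of a bilinear form as a submodule. -/
def domain (hb : IsBilinearFormOn D a) : Submodule ℝ H where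
  carrier := D
  zero_mem' := hb.zero_mem
  add_mem' := fun {u v} hu hv => hb.add_mem u hu v hv
  smul_mem' := fun c u hu => hb.smul_mem c u hu

theorem sub_mem (hb : IsBilinearFormOn D a) {u v : H} (hu : u ∈ D) (hv : v ∈ D) : u - v ∈ D :=
  hb.domain.sub_mem hu hv

/-- The form domain, to be equipped with the inner product `a(u,v) + (u,v)`. -/
def FormDomain (hb : IsBilinearFormOn D a) : Type _ := hb.domain

/-- Only the algebraic structure is transferred from the submodule; the norm of `H` is left behind
to make room for the form norm. -/
instance (hb : IsBilinearFormOn D a) : AddCommGroup hb.FormDomain :=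
  inferInstanceAs (AddCommGroup hb.domain)

instance (hb : IsBilinearFormOn D a) : Module ℝ hb.FormDomain :=
  inferInstanceAs (Module ℝ hb.domain)

/-- The inclusion of the form domain. -/
def incl (hb : IsBilinearFormOn D a) : hb.FormDomain →ₗ[ℝ] H := hb.domain.subtype

/-- An element of the form domain. -/
def ofMem (hb : IsBilinearFormOn D a) (u : H) (hu : u ∈ D) : hb.FormDomain := ⟨u, hu⟩

theorem incl_ofMem (hb : IsBilinearFormOn D a) (u : H) (hu : u ∈ D) :
    hb.incl (hb.ofMem u hu) = u := rfl

theorem incl_mem (hb : IsBilinearFormOn D a) (u : hb.FormDomain) : hb.incl u ∈ D := u.2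

theorem incl_injective (hb : IsBilinearFormOn D a) : Function.Injective hb.incl :=
  Subtype.val_injective

/-- The inner product `a(u,v) + (u,v)` on the domain of a non-negative symmetric form. -/
@[reducible] def core (hb : IsBilinearFormOn D a) (hsym : IsSymmetricFormOn D a)
    (hnn : IsNonnegFormOn D a) :
    InnerProductSpace.Core ℝ hb.FormDomain where
  inner u v := a (hb.incl u) (hb.incl v) + inner ℝ (hb.incl u) (hb.incl v)
  conj_inner_symm u v := by
    simp [hsym _ (hb.incl_mem u) _ (hb.incl_mem v), real_inner_comm]
  re_inner_nonneg u := by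
    have := hnn _ (hb.incl_mem u)
    have h2 : 0 ≤ inner ℝ (hb.incl u) (hb.incl u) := real_inner_self_nonneg
    simpa using add_nonneg this h2
  add_left u v w := by
    simp only [map_add, inner_add_left,
      hb.add_left _ (hb.incl_mem u) _ (hb.incl_mem v) _ (hb.incl_mem w)]
    ring
  smul_left u v c := by
    simp only [map_smul, real_inner_smul_left,
      hb.smul_left c _ (hb.incl_mem u) _ (hb.incl_mem v), conj_trivial]
    ring
  definite u hu := by
    have h1 := hnn _ (hb.incl_mem u)
    have h2 : 0 ≤ inner ℝ (hb.incl u) (hb.incl u) := real_inner_self_nonneg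
    have h3 : inner ℝ (hb.incl u) (hb.incl u) = 0 := by
      change a (hb.incl u) (hb.incl u) + inner ℝ (hb.incl u) (hb.incl u) = 0 at hu
      linarith
    exact hb.incl_injective (by rw [inner_self_eq_zero.1 h3, map_zero])

/-- Riesz representation of the functional `v ↦ (f,v)` in the form domain, where it is bounded
because the form norm dominates that of `H`. -/
theorem exists_resolvent (hb : IsBilinearFormOn D a) (hsym : IsSymmetricFormOn D a)
    (hnn : IsNonnegFormOn D a) (hcl : IsClosedFormOn D a) (f : H) :
    ∃ u ∈ D, ∀ v ∈ D, a u v + inner ℝ u v = inner ℝ f v := by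
  let c := hb.core hsym hnn
  let : NormedAddCommGroup hb.FormDomain := c.toNormedAddCommGroup
  let : InnerProductSpace ℝ hb.FormDomain := InnerProductSpace.ofCore c.toCore
  have hinner : ∀ u v : hb.FormDomain,
      inner ℝ u v = a (hb.incl u) (hb.incl v) + inner ℝ (hb.incl u) (hb.incl v) :=
    fun _ _ => rfl
  have hnorm : ∀ u : hb.FormDomain, ‖u‖ ^ 2 = shiftedForm a 1 (hb.incl u) (hb.incl u) := by
    intro u
    rw [← real_inner_self_eq_norm_sq, hinner, shiftedForm, one_mul]
  -- Closedness with `lam = 1` is completeness in the form norm.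
  have hcomplete : CompleteSpace hb.FormDomain := by
    refine UniformSpace.complete_of_cauchySeq_tendsto fun u hu => ?_
    obtain ⟨w, hw, hlim⟩ := hcl 1 one_pos (fun k => hb.incl (u k)) (fun k => hb.incl_mem _) (by
      have h1 := (cauchySeq_iff_tendsto_dist_atTop_0.1 hu).pow 2
      simpa [dist_eq_norm, hnorm] using h1)
    refine ⟨hb.ofMem w hw, ?_⟩
    rw [tendsto_iff_norm_sub_tendsto_zero]
    have h1 : Tendsto (fun k => ‖u k - hb.ofMem w hw‖ ^ 2) atTop (𝓝 0) := by
      simp only [hnorm, map_sub, incl_ofMem]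
      exact hlim
    simpa using h1.sqrt
  have hle : ∀ v : hb.FormDomain, ‖hb.incl v‖ ≤ ‖v‖ := by
    intro v
    refine le_of_sq_le_sq ?_ (norm_nonneg _)
    rw [hnorm, shiftedForm, one_mul, real_inner_self_eq_norm_sq]
    linarith [hnn _ (hb.incl_mem v)]
  let ℓ : StrongDual ℝ hb.FormDomain :=
    (innerSL ℝ f).comp (hb.incl.mkContinuous 1 (by simpa using hle))
  refine ⟨hb.incl ((InnerProductSpace.toDual ℝ hb.FormDomain).symm ℓ), hb.incl_mem _,
    fun v hv => ?_⟩
  have := InnerProductSpace.toDual_symm_apply (x := hb.ofMem v hv) (y := ℓ)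
  rw [hinner] at this
  exact this

/-- A vector representing `a(u, ·)` on a dense form domain is unique. -/
theorem repr_unique (hd : Dense D) {u f g : H} (hf : ∀ v ∈ D, a u v = inner ℝ f v)
    (hg : ∀ v ∈ D, a u v = inner ℝ g v) : f = g :=
  hd.eq_of_inner_left ℝ fun v hv => (hf v hv).symm.trans (hg v hv)

/-- The domain of the operator associated with a form. -/
def operatorDomain (hb : IsBilinearFormOn D a) : Submodule ℝ H where
  carrier := {u | u ∈ D ∧ ∃ f : H, ∀ v ∈ D, a u v = inner ℝ f v}
  zero_mem' := ⟨hb.zero_mem, 0, fun v hv => by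
    simpa using hb.smul_left 0 0 hb.zero_mem v hv⟩
  add_mem' := by
    rintro u w ⟨hu, f, hf⟩ ⟨hw, g, hg⟩
    exact ⟨hb.add_mem u hu w hw, f + g, fun v hv => by
      rw [hb.add_left u hu w hw v hv, hf v hv, hg v hv, inner_add_left]⟩
  smul_mem' := by
    rintro c u ⟨hu, f, hf⟩
    exact ⟨hb.smul_mem c u hu, c • f, fun v hv => by
      rw [hb.smul_left c u hu v hv, hf v hv, real_inner_smul_left]⟩

/-- Density makes the representing vector unique, so the choice `F` is automatically linear. -/
theorem exists_associatedOperator (hb : IsBilinearFormOn D a) (hd : Dense D) :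
    ∃ A : H →ₗ.[ℝ] H, IsAssociatedOperator D a A := by
  choose F hF using fun u : hb.operatorDomain => u.2.2
  let A : H →ₗ.[ℝ] H :=
    { domain := hb.operatorDomain
      toFun :=
        { toFun := F
          map_add' := fun u w => repr_unique hd (hF _) fun v hv => by
            rw [Submodule.coe_add, hb.add_left _ u.2.1 _ w.2.1 v hv, hF u v hv, hF w v hv,
              inner_add_left]
          map_smul' := fun c u => repr_unique hd (hF _) fun v hv => by
            rw [Submodule.coe_smul, hb.smul_left c _ u.2.1 v hv, hF u v hv, RingHom.id_apply,
              real_inner_smul_left] } }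
  have hA : ∀ u : hb.operatorDomain, A u = F u := fun _ => rfl
  refine ⟨A, fun u => Iff.rfl, fun u f => ⟨?_, fun h => repr_unique hd (hF u) h⟩⟩
  rintro rfl
  exact hF u

theorem associatedOperator_unique {A B : H →ₗ.[ℝ] H}
    (hA : IsAssociatedOperator D a A) (hB : IsAssociatedOperator D a B) : A = B := by
  refine LinearPMap.ext (Submodule.ext fun u => (hA.1 u).trans (hB.1 u).symm) ?_
  intro u hu hu'
  exact (hA.2 ⟨u, hu⟩ _).2 ((hB.2 ⟨u, hu'⟩ _).1 rfl)

theorem isSelfAdjoint_associatedOperator [CompleteSpace H] (hb : IsBilinearFormOn D a)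
    (hsym : IsSymmetricFormOn D a) (hnn : IsNonnegFormOn D a) (hcl : IsClosedFormOn D a)
    {A : H →ₗ.[ℝ] H} (hA : IsAssociatedOperator D a A) : IsSelfAdjoint A := by
  have hD : ∀ x : A.domain, (x : H) ∈ D := fun x => ((hA.1 x).1 x.2).1
  have hval : ∀ (x : A.domain), ∀ v ∈ D, a x v = inner ℝ (A x) v := fun x => (hA.2 x _).1 rfl
  have hsurj : ∀ f : H, ∃ x : A.domain, A x + x = f := by
    intro f
    obtain ⟨u, hu, h⟩ := hb.exists_resolvent hsym hnn hcl f
    have hu' : ∀ v ∈ D, a u v = inner ℝ (f - u) v := fun v hv => by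
      rw [inner_sub_left]; linarith [h v hv]
    refine ⟨⟨u, (hA.1 u).2 ⟨hu, _, hu'⟩⟩, ?_⟩
    rw [(hA.2 ⟨u, _⟩ _).2 hu', sub_add_cancel]
  have hformal : A.IsFormalAdjoint A := fun x y => by
    rw [← hval x y (hD y), hsym _ (hD x) _ (hD y), hval y x (hD x), real_inner_comm]
  have hdense : Dense (A.domain : Set H) := by
    rw [Submodule.dense_iff_topologicalClosure_eq_top, Submodule.topologicalClosure_eq_top_iff,
      Submodule.eq_bot_iff]
    intro f hf
    obtain ⟨x, rfl⟩ := hsurj f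
    -- If `f = A x + x` is orthogonal to the domain, pairing it with `x` gives `a(x,x) + ‖x‖² = 0`.
    have h0 := (Submodule.mem_orthogonal' _ _).1 hf x x.2
    rw [inner_add_left, ← hval x x (hD x)] at h0
    have h1 := hnn x (hD x)
    have h2 : 0 ≤ inner ℝ (x : H) x := real_inner_self_nonneg
    have hx : x = 0 := Subtype.ext (inner_self_eq_zero.1 (by linarith : inner ℝ (x : H) x = 0))
    rw [hx, A.map_zero]; simp
  have hle := hformal.le_adjoint hdense
  refine (LinearPMap.eq_of_le_of_domain_eq hle (le_antisymm hle.1 fun y hy => ?_)).symm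
  -- With this `x` in the domain of `A`, the difference `y - x` is orthogonal to the range of `A +
  -- 1`, which is all of `H`.
  obtain ⟨x, hx⟩ := hsurj (A.adjoint ⟨y, hy⟩ + y)
  have hyx : y = x := by
    refine ext_inner_left ℝ fun f => ?_
    obtain ⟨z, rfl⟩ := hsurj f
    have h1 := LinearPMap.adjoint_isFormalAdjoint hdense ⟨y, hy⟩ z
    have h2 := hformal x z
    have h3 : inner ℝ (A x + x) (z : H) = inner ℝ (A.adjoint ⟨y, hy⟩ + y) (z : H) := by rw [hx]
    rw [inner_add_left, inner_add_left] at h3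
    rw [real_inner_comm, real_inner_comm (x : H), inner_add_right, inner_add_right]
    simp only at h1
    linarith
  rw [hyx]
  exact x.2

end IsBilinearFormOn

end Forms

/-! ### The boundary of a Lipschitz set is a null set -/

section Boundary

variable {n : ℕ}

/-- The graph of a continuous function over a hyperplane is a null set. -/
theorem volume_graph_hyperplane_eq_zero {e : EuclideanSpace ℝ (Fin n)} (he : ‖e‖ = 1)
    {γ : EuclideanSpace ℝ (Fin n) → ℝ} (hγ : Continuous γ) :
    volume {x | γ (x - inner ℝ e x • e) = inner ℝ e x} = 0 := by
  have hee : inner ℝ e e = 1 := by rw [real_inner_self_eq_norm_sq, he, one_pow]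
  -- Infinitely many disjoint translates by a bounded sequence of vectors force measure zero; a
  -- graph is disjoint from its vertical shifts.
  refine Measure.addHaar_eq_zero_of_disjoint_translates volume
    (fun k : ℕ => ((1 : ℝ) / (k + 1)) • e) ?_ ?_ ?_
  · refine (Metric.isBounded_closedBall (x := (0 : EuclideanSpace ℝ (Fin n))) (r := 1)).subset ?_
    rintro _ ⟨k, rfl⟩
    rw [mem_closedBall_zero_iff, norm_smul, he, mul_one, Real.norm_of_nonneg (by positivity)]
    rw [div_le_one (by positivity)]
    linarith [(Nat.cast_nonneg k : (0 : ℝ) ≤ k)]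
  · intro j k hjk
    rw [Function.onFun, Set.disjoint_left]
    rintro z hj hk
    simp only [Set.singleton_add, Set.mem_image, Set.mem_ofPred_eq] at hj hk
    obtain ⟨x, hx, rfl⟩ := hj
    obtain ⟨y, hy, hxy⟩ := hk
    apply hjk
    set c : ℝ := 1 / ((j : ℝ) + 1) with hc
    set d : ℝ := 1 / ((k : ℝ) + 1) with hd
    have hxy' : y = x + (c - d) • e := by
      rw [sub_smul, add_sub, add_comm x, ← hxy, add_sub_cancel_left]
    have hin : inner ℝ e y = inner ℝ e x + (c - d) := by
      rw [hxy', inner_add_right, real_inner_smul_right, hee, mul_one]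
    have hproj : y - inner ℝ e y • e = x - inner ℝ e x • e := by
      rw [hin, hxy', add_smul]; abel
    have hcd : c = d := by rw [hproj, hx, hin] at hy; linarith
    rw [hc, hd, one_div, one_div, inv_inj] at hcd
    exact_mod_cast add_right_cancel hcd
  · exact measurableSet_eq_fun (by fun_prop) (by fun_prop)

/-- Locally the boundary lies in the graph: strictly below it there are no points of `Ω` nearby, and
strictly above it one is inside the open set `Ω`. -/
theorem HasLipschitzBoundary.volume_frontier {Ω : Set (EuclideanSpace ℝ (Fin n))}
    (h : HasLipschitzBoundary Ω) (hΩ : IsOpen Ω) : volume (frontier Ω) = 0 := by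
  refine measure_null_of_locally_null _ fun z hz => ?_
  obtain ⟨r, e, K, γ, hr, he, hγ, hgraph⟩ := h z hz
  refine ⟨frontier Ω ∩ Metric.ball z r, inter_mem_nhdsWithin _ (Metric.ball_mem_nhds z hr),
    measure_mono_null ?_ (volume_graph_hyperplane_eq_zero he hγ.continuous)⟩
  rintro x ⟨hx, hxr⟩
  have hγc := hγ.continuous
  refine le_antisymm ?_ (not_lt.1 fun hlt => ?_)
  · by_contra! hlt
    have h1 : ∀ᶠ y in 𝓝 x, inner ℝ e y < γ (y - inner ℝ e y • e) :=
      ContinuousAt.eventually_lt (by fun_prop) (by fun_prop) hlt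
    obtain ⟨y, hy, hlt', hyr⟩ := (mem_closure_iff_frequently.1 hx.1).and_eventually
      (h1.and (Metric.isOpen_ball.mem_nhds hxr)) |>.exists
    exact absurd ((hgraph y hyr).1 hy) hlt'.le.not_gt
  · exact (hΩ.frontier_eq ▸ hx).2 ((hgraph x hxr).2 hlt)

end Boundary

/-! ### The kernel -/

section Kernel

variable {n : ℕ} {s : ℝ}

theorem distPow_nonneg (s : ℝ) (x y : EuclideanSpace ℝ (Fin n)) : 0 ≤ distPow s x y :=
  Real.rpow_nonneg (norm_nonneg _) _

theorem distPow_comm (s : ℝ) (x y : EuclideanSpace ℝ (Fin n)) : distPow s x y = distPow s y x := by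
  rw [distPow, distPow, norm_sub_rev]

theorem measurable_distPow (s : ℝ) :
    Measurable fun p : EuclideanSpace ℝ (Fin n) × EuclideanSpace ℝ (Fin n) =>
      distPow s p.1 p.2 := by
  unfold distPow
  fun_prop

theorem measurable_distPow_left (s : ℝ) (x : EuclideanSpace ℝ (Fin n)) :
    Measurable fun y => distPow s x y := by
  unfold distPow
  fun_prop

/-- Away from `closure Ω`, the kernel is bounded on `Ω`. -/
theorem exists_abs_one_div_distPow_le (hs : 0 < s) {Ω : Set (EuclideanSpace ℝ (Fin n))}
    {x : EuclideanSpace ℝ (Fin n)} (hx : x ∈ (closure Ω)ᶜ) :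
    ∃ K : ℝ, ∀ y ∈ Ω, |1 / distPow s x y| ≤ K := by
  obtain ⟨δ, hδ, hball⟩ := Metric.isOpen_iff.1 isClosed_closure.isOpen_compl x hx
  refine ⟨1 / δ ^ ((n : ℝ) + 2 * s), fun y hy => ?_⟩
  have hle : δ ≤ ‖x - y‖ := by
    by_contra! h
    exact hball (by rwa [Metric.mem_ball, dist_comm, dist_eq_norm]) (subset_closure hy)
  rw [abs_of_nonneg (one_div_nonneg.2 (distPow_nonneg s x y))]
  have hp : 0 ≤ (n : ℝ) + 2 * s := by positivity
  exact one_div_le_one_div_of_le (by positivity) (Real.rpow_le_rpow hδ.le hle hp)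

/-- Near the origin the order of the singularity is `n + 2s - 2 < n`, as `s < 1`; at infinity the
decay has order `n + 2s > n`, as `s > 0`. -/
theorem integrable_min_one_sq_div_norm_rpow (hn : 1 ≤ n) (hs0 : 0 < s) (hs1 : s < 1) :
    Integrable fun z : EuclideanSpace ℝ (Fin n) =>
      min 1 (‖z‖ ^ 2) / ‖z‖ ^ ((n : ℝ) + 2 * s) := by
  have hmeas : Measurable fun z : EuclideanSpace ℝ (Fin n) =>
      min 1 (‖z‖ ^ 2) / ‖z‖ ^ ((n : ℝ) + 2 * s) := by fun_prop
  have hnn : ∀ z : EuclideanSpace ℝ (Fin n), 0 ≤ min 1 (‖z‖ ^ 2) / ‖z‖ ^ ((n : ℝ) + 2 * s) :=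
    fun z => by positivity
  have hp : 0 < (n : ℝ) + 2 * s := by positivity
  rw [← integrableOn_univ, ← Set.union_compl_self (Metric.ball (0 : EuclideanSpace ℝ (Fin n)) 1)]
  refine IntegrableOn.union ?_ ?_
  · refine integrableOn_ball_of_norm_le_rpow (C := 1) (α := n + 2 * s - 2)
      (by rwa [finrank_euclideanSpace_fin]) (by rw [finrank_euclideanSpace_fin]; linarith)
      (ae_of_all _ fun z => ?_) hmeas.aestronglyMeasurable
    rw [Real.norm_of_nonneg (hnn z), one_mul]
    rcases (norm_nonneg z).eq_or_lt with hz | hz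
    · rw [← hz, Real.zero_rpow hp.ne', div_zero]
      positivity
    · rw [neg_sub, Real.rpow_sub hz, Real.rpow_two]
      gcongr
      exact min_le_right _ _
  · have hint := (integrable_one_add_norm (E := EuclideanSpace ℝ (Fin n)) (μ := volume)
      (r := n + 2 * s) (by rw [finrank_euclideanSpace_fin]; linarith)).const_mul
      ((2 : ℝ) ^ ((n : ℝ) + 2 * s))
    refine Integrable.mono' hint.integrableOn hmeas.aestronglyMeasurable ?_
    refine (ae_restrict_iff' Metric.isOpen_ball.measurableSet.compl).2 (ae_of_all _ fun z hz => ?_)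
    have hz1 : 1 ≤ ‖z‖ := by simpa using hz
    rw [Real.norm_of_nonneg (hnn z), Real.rpow_neg (by positivity), ← div_eq_mul_inv,
      ← Real.div_rpow (by positivity) (by positivity)]
    calc min 1 (‖z‖ ^ 2) / ‖z‖ ^ ((n : ℝ) + 2 * s) ≤ 1 / ‖z‖ ^ ((n : ℝ) + 2 * s) := by
          gcongr; exact min_le_left _ _
      _ = (1 / ‖z‖) ^ ((n : ℝ) + 2 * s) := by
          rw [Real.div_rpow zero_le_one (by positivity), Real.one_rpow]
      _ ≤ _ := by
          refine Real.rpow_le_rpow (by positivity) ?_ hp.le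
          rw [div_le_div_iff₀ (by positivity) (by positivity)]
          linarith

theorem fracConst_pos (hs0 : 0 < s) (hs1 : s < 1) : 0 < fracConst n s := by
  have h1 : 0 < Real.Gamma ((2 * s + n) / 2) := Real.Gamma_pos_of_pos (by positivity)
  have h2 : 0 < Real.Gamma (1 - s) := Real.Gamma_pos_of_pos (by linarith)
  have := Real.pi_pos
  unfold fracConst
  positivity

end Kernel

/-! ### The space `W^{s,2}_Ω` and its energy as an `L²` pairing -/

section Sobolev

variable {n : ℕ} {s : ℝ} {Ω : Set (EuclideanSpace ℝ (Fin n))}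
  {u v w u' v' : EuclideanSpace ℝ (Fin n) → ℝ}

/-- The quotient `(u(x) - u(y)) / |x - y|^((n+2s)/2)`, whose square is integrated in the norm of
`W^{s,2}_Ω`. -/
def fracQuotient (s : ℝ) (u : EuclideanSpace ℝ (Fin n) → ℝ)
    (p : EuclideanSpace ℝ (Fin n) × EuclideanSpace ℝ (Fin n)) : ℝ :=
  (u p.1 - u p.2) / √(distPow s p.1 p.2)

theorem fracQuotient_mul (s : ℝ) (u v : EuclideanSpace ℝ (Fin n) → ℝ)
    (p : EuclideanSpace ℝ (Fin n) × EuclideanSpace ℝ (Fin n)) :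
    fracQuotient s u p * fracQuotient s v p =
      (u p.1 - u p.2) * (v p.1 - v p.2) / distPow s p.1 p.2 := by
  rw [fracQuotient, fracQuotient, div_mul_div_comm, Real.mul_self_sqrt (distPow_nonneg _ _ _)]

theorem fracQuotient_sq (s : ℝ) (u : EuclideanSpace ℝ (Fin n) → ℝ)
    (p : EuclideanSpace ℝ (Fin n) × EuclideanSpace ℝ (Fin n)) :
    fracQuotient s u p ^ 2 = (u p.1 - u p.2) ^ 2 / distPow s p.1 p.2 := by
  rw [sq, fracQuotient_mul, ← sq]

theorem fracQuotient_add (s : ℝ) (u v : EuclideanSpace ℝ (Fin n) → ℝ) :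
    fracQuotient s (u + v) = fracQuotient s u + fracQuotient s v := by
  ext p; simp only [fracQuotient, Pi.add_apply]; ring

theorem fracQuotient_smul (s c : ℝ) (u : EuclideanSpace ℝ (Fin n) → ℝ) :
    fracQuotient s (c • u) = c • fracQuotient s u := by
  ext p; simp only [fracQuotient, Pi.smul_apply, smul_eq_mul]; ring

/-- The measure on `Ω × ℝⁿ` which counts the pairs in `Ω × Ω` with weight one half. -/
def interactionMeasure (Ω : Set (EuclideanSpace ℝ (Fin n))) :
    Measure (EuclideanSpace ℝ (Fin n) × EuclideanSpace ℝ (Fin n)) :=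
  (2⁻¹ : ENNReal) • volume.restrict (Ω ×ˢ Ω) + volume.restrict (Ω ×ˢ Ωᶜ)

theorem interactionMeasure_absolutelyContinuous (Ω : Set (EuclideanSpace ℝ (Fin n))) :
    interactionMeasure Ω ≪ volume :=
  (Measure.absolutelyContinuous_of_le Measure.restrict_le_self).smul_left _ |>.add_left
    (Measure.absolutelyContinuous_of_le Measure.restrict_le_self)

theorem ae_comp_fst_snd {P : EuclideanSpace ℝ (Fin n) → Prop} (h : ∀ᵐ x, P x) :
    ∀ᵐ p : EuclideanSpace ℝ (Fin n) × EuclideanSpace ℝ (Fin n), P p.1 ∧ P p.2 :=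
  (Measure.quasiMeasurePreserving_fst.ae h).and (Measure.quasiMeasurePreserving_snd.ae h)

theorem fracQuotient_ae_congr (s : ℝ) (h : u =ᵐ[volume] u') :
    fracQuotient s u =ᵐ[volume] fracQuotient s u' := by
  filter_upwards [ae_comp_fst_snd h] with p hp
  rw [fracQuotient, fracQuotient, hp.1, hp.2]

theorem aemeasurable_fracQuotient (hu : AEMeasurable u) :
    AEMeasurable (fracQuotient s u) volume :=
  ((hu.comp_quasiMeasurePreserving Measure.quasiMeasurePreserving_fst).sub
    (hu.comp_quasiMeasurePreserving Measure.quasiMeasurePreserving_snd)).div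
    (measurable_distPow s).sqrt.aemeasurable

/-- Half of the Gagliardo seminorm, with values in `[0, ∞]`. -/
def gagliardo (s : ℝ) (Ω : Set (EuclideanSpace ℝ (Fin n)))
    (u : EuclideanSpace ℝ (Fin n) → ℝ) : ENNReal :=
  ∫⁻ p, ENNReal.ofReal (fracQuotient s u p ^ 2) ∂interactionMeasure Ω

theorem gagliardo_congr (h : u =ᵐ[volume] u') : gagliardo s Ω u = gagliardo s Ω u' :=
  lintegral_congr_ae <| by
    filter_upwards [interactionMeasure_absolutelyContinuous Ω (fracQuotient_ae_congr s h)] with p hp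
    rw [hp]

theorem gagliardo_eq (s : ℝ) (Ω : Set (EuclideanSpace ℝ (Fin n)))
    (u : EuclideanSpace ℝ (Fin n) → ℝ) :
    gagliardo s Ω u = 2⁻¹ * (∫⁻ p in Ω ×ˢ Ω, ENNReal.ofReal (fracQuotient s u p ^ 2)) +
      ∫⁻ p in Ω ×ˢ Ωᶜ, ENNReal.ofReal (fracQuotient s u p ^ 2) := by
  rw [gagliardo, interactionMeasure, lintegral_add_measure, lintegral_smul_measure, smul_eq_mul]

/-- The integrand is symmetric under exchange of the variables, so `Ωᶜ × Ω` contributes as much as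
`Ω × Ωᶜ`; the factor 2 undoes the weight one half on `Ω × Ω`. -/
theorem sobolevNormSq_eq (hΩ : MeasurableSet Ω) (s : ℝ) (u : EuclideanSpace ℝ (Fin n) → ℝ) :
    sobolevNormSq s Ω u =
      (∫⁻ x in Ω, ENNReal.ofReal (u x ^ 2)) + 2 * gagliardo s Ω u := by
  rw [sobolevNormSq, gagliardo_eq]
  congr 1
  simp only [← fracQuotient_sq]
  set F : EuclideanSpace ℝ (Fin n) × EuclideanSpace ℝ (Fin n) → ENNReal :=
    fun p => ENNReal.ofReal (fracQuotient s u p ^ 2) with hF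
  have hset : (Ωᶜ ×ˢ Ωᶜ : Set (EuclideanSpace ℝ (Fin n) × EuclideanSpace ℝ (Fin n)))ᶜ =
      (Ω ×ˢ Ω ∪ Ω ×ˢ Ωᶜ) ∪ Ωᶜ ×ˢ Ω := by
    ext p; simp only [Set.mem_compl_iff, Set.mem_prod, Set.mem_union]; tauto
  have hswap : ∫⁻ p in Ωᶜ ×ˢ Ω, F p = ∫⁻ p in Ω ×ˢ Ωᶜ, F p := by
    have h := (Measure.measurePreserving_swap (μ := (volume : Measure (EuclideanSpace ℝ (Fin n))))
      (ν := (volume : Measure (EuclideanSpace ℝ (Fin n))))).setLIntegral_comp_preimage_emb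
      MeasurableEquiv.prodComm.measurableEmbedding F (Ω ×ˢ Ωᶜ)
    rw [Set.preimage_swap_prod] at h
    rw [Measure.volume_eq_prod, ← h]
    refine lintegral_congr fun p => ?_
    simp only [hF, fracQuotient_sq, Prod.fst_swap, Prod.snd_swap]
    rw [distPow_comm, ← neg_sq, neg_sub]
  rw [hset, lintegral_union (hΩ.compl.prod hΩ), lintegral_union (hΩ.prod hΩ.compl), hswap,
    mul_add, ← mul_assoc, ENNReal.mul_inv_cancel two_ne_zero ENNReal.ofNat_ne_top, one_mul,
    add_assoc, ← two_mul]
  · rw [Set.disjoint_left]; rintro p ⟨_, h⟩ ⟨_, h'⟩; exact h' h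
  · rw [Set.disjoint_left]; rintro p (⟨h, _⟩ | ⟨h, _⟩) ⟨h', _⟩ <;> exact h' h

theorem memLp_two_iff_lintegral_sq_lt_top {α : Type*} [MeasurableSpace α] {μ : Measure α}
    {f : α → ℝ} (hf : AEMeasurable f μ) :
    MemLp f 2 μ ↔ ∫⁻ x, ENNReal.ofReal (f x ^ 2) ∂μ < ⊤ := by
  rw [memLp_two_iff_integrable_sq hf.aestronglyMeasurable, Integrable,
    hasFiniteIntegral_iff_ofReal (ae_of_all _ fun x => sq_nonneg _)]
  exact and_iff_right (hf.pow_const 2).aestronglyMeasurable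

theorem mem_sobolevSpace_iff (hΩ : MeasurableSet Ω) :
    u ∈ sobolevSpace s Ω ↔ AEMeasurable u ∧ MemLp u 2 (volume.restrict Ω) ∧
      gagliardo s Ω u < ⊤ := by
  refine and_congr_right fun hu => ?_
  rw [sobolevNormSq_eq hΩ, ENNReal.add_lt_top, memLp_two_iff_lintegral_sq_lt_top hu.restrict]
  refine and_congr_right fun _ => ⟨fun h => ?_, fun h => ENNReal.mul_lt_top (by simp) h⟩
  exact ENNReal.lt_top_of_mul_ne_top_right h.ne two_ne_zero

theorem gagliardo_lt_top_iff (hu : AEMeasurable u) :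
    gagliardo s Ω u < ⊤ ↔ MemLp (fracQuotient s u) 2 (interactionMeasure Ω) :=
  (memLp_two_iff_lintegral_sq_lt_top
    ((aemeasurable_fracQuotient hu).mono_ac (interactionMeasure_absolutelyContinuous Ω))).symm

theorem memLp_fracQuotient (hΩ : MeasurableSet Ω) (hu : u ∈ sobolevSpace s Ω) :
    MemLp (fracQuotient s u) 2 (interactionMeasure Ω) :=
  (gagliardo_lt_top_iff hu.1).1 ((mem_sobolevSpace_iff hΩ).1 hu).2.2

theorem sobolevSpace_congr (hΩ : MeasurableSet Ω) (h : u =ᵐ[volume] u') :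
    u ∈ sobolevSpace s Ω ↔ u' ∈ sobolevSpace s Ω := by
  rw [mem_sobolevSpace_iff hΩ, mem_sobolevSpace_iff hΩ, gagliardo_congr h,
    memLp_congr_ae (ae_restrict_of_ae h), aemeasurable_congr h]

theorem mem_sobolevSpace_of_memLp (hΩ : MeasurableSet Ω) (hu : AEMeasurable u)
    (h1 : MemLp u 2 (volume.restrict Ω))
    (h2 : MemLp (fracQuotient s u) 2 (interactionMeasure Ω)) : u ∈ sobolevSpace s Ω :=
  (mem_sobolevSpace_iff hΩ).2 ⟨hu, h1, (gagliardo_lt_top_iff hu).2 h2⟩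

theorem add_mem_sobolevSpace (hΩ : MeasurableSet Ω) (hu : u ∈ sobolevSpace s Ω)
    (hv : v ∈ sobolevSpace s Ω) : u + v ∈ sobolevSpace s Ω := by
  refine mem_sobolevSpace_of_memLp hΩ (hu.1.add hv.1)
    (((mem_sobolevSpace_iff hΩ).1 hu).2.1.add ((mem_sobolevSpace_iff hΩ).1 hv).2.1) ?_
  rw [fracQuotient_add]
  exact (memLp_fracQuotient hΩ hu).add (memLp_fracQuotient hΩ hv)

theorem smul_mem_sobolevSpace (hΩ : MeasurableSet Ω) (c : ℝ) (hu : u ∈ sobolevSpace s Ω) :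
    c • u ∈ sobolevSpace s Ω := by
  refine mem_sobolevSpace_of_memLp hΩ (hu.1.const_smul c)
    (((mem_sobolevSpace_iff hΩ).1 hu).2.1.const_smul c) ?_
  rw [fracQuotient_smul]
  exact (memLp_fracQuotient hΩ hu).const_smul c

theorem sub_mem_sobolevSpace (hΩ : MeasurableSet Ω) (hu : u ∈ sobolevSpace s Ω)
    (hv : v ∈ sobolevSpace s Ω) : u - v ∈ sobolevSpace s Ω := by
  rw [sub_eq_add_neg, ← neg_one_smul ℝ v]
  exact add_mem_sobolevSpace hΩ hu (smul_mem_sobolevSpace hΩ _ hv)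

theorem integrable_fracQuotient_mul (hΩ : MeasurableSet Ω) (hu : u ∈ sobolevSpace s Ω)
    (hv : v ∈ sobolevSpace s Ω) :
    Integrable (fun p => fracQuotient s u p * fracQuotient s v p) (interactionMeasure Ω) :=
  (memLp_fracQuotient hΩ hu).integrable_mul (memLp_fracQuotient hΩ hv)

theorem integrableOn_prod_of_integrable_interactionMeasure
    {F : EuclideanSpace ℝ (Fin n) × EuclideanSpace ℝ (Fin n) → ℝ}
    (hF : Integrable F (interactionMeasure Ω)) :
    IntegrableOn F (Ω ×ˢ Ω) ∧ IntegrableOn F (Ω ×ˢ Ωᶜ) := by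
  rw [interactionMeasure, integrable_add_measure] at hF
  exact ⟨(integrable_smul_measure (by simp) (by simp)).1 hF.1, hF.2⟩

/-- The product of two `L²` quotients is integrable, so Fubini merges the iterated integrals into
one pairing, from which the algebra of the energy follows. -/
theorem energy_eq (hΩ : MeasurableSet Ω) (hu : u ∈ sobolevSpace s Ω)
    (hv : v ∈ sobolevSpace s Ω) :
    energy s Ω u v = fracConst n s *
      ∫ p, fracQuotient s u p * fracQuotient s v p ∂interactionMeasure Ω := by
  obtain ⟨h1, h2⟩ := integrableOn_prod_of_integrable_interactionMeasure
    (integrable_fracQuotient_mul hΩ hu hv)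
  rw [interactionMeasure, integral_add_measure (h1.smul_measure (by simp)) h2,
    integral_smul_measure, Measure.volume_eq_prod, setIntegral_prod _ h1, setIntegral_prod _ h2]
  simp only [fracQuotient_mul, energy, smul_eq_mul, ENNReal.toReal_inv, ENNReal.toReal_ofNat]
  ring

theorem energy_comm (hΩ : MeasurableSet Ω) (hu : u ∈ sobolevSpace s Ω)
    (hv : v ∈ sobolevSpace s Ω) : energy s Ω u v = energy s Ω v u := by
  rw [energy_eq hΩ hu hv, energy_eq hΩ hv hu]
  simp only [mul_comm]

theorem energy_congr_left (hΩ : MeasurableSet Ω) (h : u =ᵐ[volume] u')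
    (hu : u ∈ sobolevSpace s Ω) (hv : v ∈ sobolevSpace s Ω) :
    energy s Ω u v = energy s Ω u' v := by
  rw [energy_eq hΩ hu hv, energy_eq hΩ ((sobolevSpace_congr hΩ h).1 hu) hv]
  congr 1
  refine integral_congr_ae ?_
  filter_upwards [interactionMeasure_absolutelyContinuous Ω (fracQuotient_ae_congr s h)] with p hp
  rw [hp]

theorem energy_add_left (hΩ : MeasurableSet Ω) (hu : u ∈ sobolevSpace s Ω)
    (hv : v ∈ sobolevSpace s Ω) (hw : w ∈ sobolevSpace s Ω) :
    energy s Ω (u + v) w = energy s Ω u w + energy s Ω v w := by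
  rw [energy_eq hΩ (add_mem_sobolevSpace hΩ hu hv) hw, energy_eq hΩ hu hw, energy_eq hΩ hv hw,
    ← mul_add, ← integral_add (integrable_fracQuotient_mul hΩ hu hw)
      (integrable_fracQuotient_mul hΩ hv hw)]
  simp only [fracQuotient_add, Pi.add_apply, add_mul]

theorem energy_smul_left (hΩ : MeasurableSet Ω) (c : ℝ) (hu : u ∈ sobolevSpace s Ω)
    (hw : w ∈ sobolevSpace s Ω) : energy s Ω (c • u) w = c * energy s Ω u w := by
  rw [energy_eq hΩ (smul_mem_sobolevSpace hΩ c hu) hw, energy_eq hΩ hu hw]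
  simp only [fracQuotient_smul, Pi.smul_apply, smul_eq_mul, mul_assoc, integral_const_mul]
  ring

theorem energy_self_eq (hΩ : MeasurableSet Ω) (hu : u ∈ sobolevSpace s Ω) :
    energy s Ω u u = fracConst n s * (gagliardo s Ω u).toReal := by
  rw [energy_eq hΩ hu hu, gagliardo]
  congr 1
  simp only [← sq]
  exact integral_eq_lintegral_of_nonneg_ae (ae_of_all _ fun p => sq_nonneg _)
    (memLp_fracQuotient hΩ hu).integrable_sq.aestronglyMeasurable

/-- Bounded Lipschitz functions belong to `W^{s,2}_Ω`. -/
theorem mem_sobolevSpace_of_lipschitz (hn : 1 ≤ n) (hs0 : 0 < s) (hs1 : s < 1)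
    (hΩ : MeasurableSet Ω) (hfin : volume Ω ≠ ⊤) {K : NNReal} (hu : LipschitzWith K u) {M : ℝ}
    (hM : ∀ x, |u x| ≤ M) : u ∈ sobolevSpace s Ω := by
  have : IsFiniteMeasure (volume.restrict Ω) :=
    ⟨by rw [Measure.restrict_apply_univ]; exact hfin.lt_top⟩
  have hum : Measurable u := hu.continuous.measurable
  refine (mem_sobolevSpace_iff hΩ).2 ⟨hum.aemeasurable,
    (memLp_top_of_bound hum.aestronglyMeasurable M (ae_of_all _ hM)).mono_exponent le_top, ?_⟩
  set k : EuclideanSpace ℝ (Fin n) → ℝ :=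
    fun z => min 1 (‖z‖ ^ 2) / ‖z‖ ^ ((n : ℝ) + 2 * s) with hk
  have hkint : Integrable k := integrable_min_one_sq_div_norm_rpow hn hs0 hs1
  have hknn : ∀ z, 0 ≤ k z := fun z => by simp only [hk]; positivity
  have hkm : Measurable k := by fun_prop
  -- The first entry bounds `(u x - u y)²` by boundedness, the second bounds it by a multiple of `|x
  -- - y|²`.
  set L : ℝ := max ((2 * M) ^ 2) ((K : ℝ) ^ 2) with hL
  have hL0 : 0 ≤ L := le_max_of_le_right (sq_nonneg _)
  have hbound : ∀ x y, fracQuotient s u (x, y) ^ 2 ≤ L * k (x - y) := by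
    intro x y
    rw [fracQuotient_sq, hk, ← mul_div_assoc]
    refine div_le_div_of_nonneg_right ?_ (distPow_nonneg s x y)
    rw [mul_min_of_nonneg _ _ hL0, mul_one]
    refine le_min ?_ ?_
    · refine le_max_of_le_left (sq_le_sq' ?_ ?_) <;>
        linarith [abs_le.1 (hM x), abs_le.1 (hM y)]
    · have h1 := hu.dist_le_mul x y
      rw [Real.dist_eq, dist_eq_norm] at h1
      calc (u x - u y) ^ 2 = |u x - u y| ^ 2 := (sq_abs _).symm
        _ ≤ ((K : ℝ) * ‖x - y‖) ^ 2 := by gcongr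
        _ = (K : ℝ) ^ 2 * ‖x - y‖ ^ 2 := mul_pow _ _ _
        _ ≤ L * ‖x - y‖ ^ 2 := by gcongr; exact le_max_right _ _
  have hmain : ∫⁻ p in Ω ×ˢ Set.univ, ENNReal.ofReal (fracQuotient s u p ^ 2) < ⊤ := by
    calc ∫⁻ p in Ω ×ˢ Set.univ, ENNReal.ofReal (fracQuotient s u p ^ 2)
        ≤ ∫⁻ p in Ω ×ˢ Set.univ, ENNReal.ofReal (L * k (p.1 - p.2)) :=
          lintegral_mono fun p => ENNReal.ofReal_le_ofReal (hbound p.1 p.2)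
      _ = ∫⁻ x in Ω, ∫⁻ y, ENNReal.ofReal (L * k (x - y)) := by
          rw [Measure.volume_eq_prod, ← Measure.prod_restrict, Measure.restrict_univ,
            lintegral_prod _ (by fun_prop)]
      _ = ∫⁻ x in Ω, ∫⁻ z, ENNReal.ofReal (L * k z) := by
          refine lintegral_congr fun x => ?_
          exact lintegral_sub_left_eq_self (fun z => ENNReal.ofReal (L * k z)) x
      _ = (∫⁻ z, ENNReal.ofReal (L * k z)) * volume Ω := by
          rw [lintegral_const, Measure.restrict_apply_univ]
      _ < ⊤ := by
          refine ENNReal.mul_lt_top ?_ hfin.lt_top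
          exact (hasFiniteIntegral_iff_ofReal
            (ae_of_all _ fun z => mul_nonneg hL0 (hknn z))).1 (hkint.const_mul L).2
  rw [gagliardo_eq]
  refine ENNReal.add_lt_top.2 ⟨ENNReal.mul_lt_top (by simp) ?_, ?_⟩
  · exact (lintegral_mono_set (Set.prod_mono le_rfl (Set.subset_univ _))).trans_lt hmain
  · exact (lintegral_mono_set (Set.prod_mono le_rfl (Set.subset_univ _))).trans_lt hmain

end Sobolev

/-! ### Orthogonality and minimality of weighted means -/

section WeightedMean

variable {α : Type*} [MeasurableSpace α] {μ : Measure α} {g w : α → ℝ} {K : ℝ}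

theorem MeasureTheory.Integrable.mul_of_ae_abs_le {f : α → ℝ} (hf : Integrable f μ)
    (hw : Measurable w) (hK : ∀ᵐ y ∂μ, |w y| ≤ K) : Integrable (fun y => f y * w y) μ :=
  hf.mul_bdd hw.aestronglyMeasurable hK

theorem integral_weightedMean_sub_mul_eq_zero [IsFiniteMeasure μ] (hg : MemLp g 2 μ)
    (hw : Measurable w) (hw0 : ∀ y, 0 ≤ w y) (hK : ∀ᵐ y ∂μ, |w y| ≤ K) :
    ∫ y, (1 / (∫ z, w z ∂μ) * (∫ z, g z * w z ∂μ) - g y) * w y ∂μ = 0 := by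
  have hgw := (hg.integrable one_le_two).mul_of_ae_abs_le hw hK
  have hwi : Integrable w μ := by
    simpa using (integrable_const (1 : ℝ)).mul_of_ae_abs_le hw hK
  simp only [sub_mul]
  rw [integral_sub (hwi.const_mul _) hgw, integral_const_mul]
  -- If the total weight is zero, then `w` vanishes almost everywhere and both integrals are zero,
  -- whatever `1 / 0` means.
  by_cases h : ∫ z, w z ∂μ = 0
  · have hz : w =ᵐ[μ] 0 := (integral_eq_zero_iff_of_nonneg hw0 hwi).1 h
    have : ∫ z, g z * w z ∂μ = 0 := by
      refine integral_eq_zero_of_ae ?_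
      filter_upwards [hz] with z hz
      simp [hz]
    simp [this]
  · field_simp
    simp

theorem integrable_const_sub_mul [IsFiniteMeasure μ] (hg : MemLp g 2 μ)
    (hw : Measurable w) (hK : ∀ᵐ y ∂μ, |w y| ≤ K) (c : ℝ) :
    Integrable (fun y => (c - g y) * w y) μ :=
  ((integrable_const c).sub (hg.integrable one_le_two)).mul_of_ae_abs_le hw hK

theorem integrable_const_sub_sq_mul [IsFiniteMeasure μ] (hg : MemLp g 2 μ)
    (hw : Measurable w) (hK : ∀ᵐ y ∂μ, |w y| ≤ K) (c : ℝ) :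
    Integrable (fun y => (c - g y) ^ 2 * w y) μ :=
  ((memLp_const c).sub hg).integrable_sq.mul_of_ae_abs_le hw hK

/-- The weighted mean minimizes the weighted quadratic deviation. -/
theorem integral_weightedMean_sub_sq_mul_le [IsFiniteMeasure μ] (hg : MemLp g 2 μ)
    (hw : Measurable w) (hw0 : ∀ y, 0 ≤ w y) (hK : ∀ᵐ y ∂μ, |w y| ≤ K) (c : ℝ) :
    ∫ y, (1 / (∫ z, w z ∂μ) * (∫ z, g z * w z ∂μ) - g y) ^ 2 * w y ∂μ ≤
      ∫ y, (c - g y) ^ 2 * w y ∂μ := by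
  have h0 := integral_weightedMean_sub_mul_eq_zero hg hw hw0 hK
  set m := 1 / (∫ z, w z ∂μ) * (∫ z, g z * w z ∂μ)
  have hwi : Integrable w μ := by
    simpa using (integrable_const (1 : ℝ)).mul_of_ae_abs_le hw hK
  have h1 := integrable_const_sub_mul hg hw hK m
  have h2 := integrable_const_sub_sq_mul hg hw hK m
  have hexp : ∀ y, (c - g y) ^ 2 * w y =
      (m - g y) ^ 2 * w y + (2 * (c - m) * ((m - g y) * w y) + (c - m) ^ 2 * w y) :=
    fun y => by ring
  simp only [hexp]
  have h3 : Integrable (fun y => 2 * (c - m) * ((m - g y) * w y) + (c - m) ^ 2 * w y) μ :=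
    (h1.const_mul _).add (hwi.const_mul _)
  rw [integral_add h2 h3, integral_add (h1.const_mul _) (hwi.const_mul _), integral_const_mul,
    integral_const_mul, h0, mul_zero, zero_add]
  exact le_add_of_nonneg_right (mul_nonneg (sq_nonneg _) (integral_nonneg hw0))

end WeightedMean

/-! ### The Neumann extension: linearity, exterior condition, least energy -/

section NeumannExtension

variable {n : ℕ} {s : ℝ} {Ω : Set (EuclideanSpace ℝ (Fin n))}
  {u v : L2 Ω} {x : EuclideanSpace ℝ (Fin n)}

theorem neumannExt_of_mem (u : L2 Ω) (hx : x ∈ Ω) : neumannExt s Ω u x = u x := if_pos hx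

theorem neumannExt_of_mem_compl_closure (u : L2 Ω) (hx : x ∈ (closure Ω)ᶜ) :
    neumannExt s Ω u x = 1 / (∫ y in Ω, 1 / distPow s x y) *
      ∫ y in Ω, u y * (1 / distPow s x y) := by
  rw [neumannExt, if_neg fun h => hx (subset_closure h), if_pos hx, rhoFun]
  simp only [mul_one_div]

theorem neumannExt_of_mem_frontier (u : L2 Ω) (h : x ∉ Ω) (hx : x ∈ closure Ω) :
    neumannExt s Ω u x = 0 := by
  rw [neumannExt, if_neg h, if_neg fun h' => h' hx]

theorem measurable_neumannExt (hopen : IsOpen Ω) (u : L2 Ω) : Measurable (neumannExt s Ω u) := by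
  have hu : Measurable u := (Lp.stronglyMeasurable u).measurable
  have hd := measurable_distPow (n := n) s
  unfold neumannExt
  refine Measurable.ite hopen.measurableSet hu (Measurable.ite
    isClosed_closure.isOpen_compl.measurableSet (Measurable.mul (Measurable.const_div ?_ 1) ?_)
    measurable_const)
  · exact (StronglyMeasurable.integral_prod_right (f := fun x y => 1 / distPow s x y)
      (hd.const_div 1).stronglyMeasurable).measurable
  · exact (StronglyMeasurable.integral_prod_right (f := fun x y => u y / distPow s x y)
      ((hu.comp measurable_snd).div hd).stronglyMeasurable).measurable

theorem measurable_one_div_distPow (s : ℝ) (x : EuclideanSpace ℝ (Fin n)) :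
    Measurable fun y => 1 / distPow s x y :=
  (measurable_distPow_left s x).const_div 1

theorem one_div_distPow_nonneg (s : ℝ) (x y : EuclideanSpace ℝ (Fin n)) :
    0 ≤ 1 / distPow s x y :=
  one_div_nonneg.2 (distPow_nonneg s x y)

theorem exists_ae_abs_one_div_distPow_le (hs0 : 0 < s) (hΩ : MeasurableSet Ω)
    (hx : x ∈ (closure Ω)ᶜ) :
    ∃ K : ℝ, ∀ᵐ y ∂volume.restrict Ω, |1 / distPow s x y| ≤ K := by
  obtain ⟨K, hK⟩ := exists_abs_one_div_distPow_le hs0 hx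
  exact ⟨K, (ae_restrict_iff' hΩ).2 (ae_of_all _ hK)⟩

theorem integrable_mul_one_div_distPow [IsFiniteMeasure (volume.restrict Ω)] (hs0 : 0 < s)
    (hΩ : MeasurableSet Ω) (u : L2 Ω) (hx : x ∈ (closure Ω)ᶜ) :
    Integrable (fun y => u y * (1 / distPow s x y)) (volume.restrict Ω) := by
  obtain ⟨K, hK⟩ := exists_ae_abs_one_div_distPow_le hs0 hΩ hx
  exact ((Lp.memLp u).integrable one_le_two).mul_of_ae_abs_le (measurable_one_div_distPow s x) hK

/-- Outside `Ω` the argument is pointwise, as integrals ignore the choice of representative; inside,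
representatives in `Lp` add only almost everywhere. -/
theorem neumannExt_add [IsFiniteMeasure (volume.restrict Ω)] (hs0 : 0 < s) (hΩ : MeasurableSet Ω)
    (u v : L2 Ω) :
    neumannExt s Ω (u + v) =ᵐ[volume] neumannExt s Ω u + neumannExt s Ω v := by
  filter_upwards [(ae_restrict_iff' hΩ).1 (Lp.coeFn_add u v)] with x hx
  rw [Pi.add_apply]
  by_cases h : x ∈ Ω
  · rw [neumannExt_of_mem _ h, neumannExt_of_mem _ h, neumannExt_of_mem _ h, hx h, Pi.add_apply]
  by_cases h' : x ∈ closure Ω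
  · rw [neumannExt_of_mem_frontier _ h h', neumannExt_of_mem_frontier _ h h',
      neumannExt_of_mem_frontier _ h h', add_zero]
  · rw [neumannExt_of_mem_compl_closure _ h', neumannExt_of_mem_compl_closure _ h',
      neumannExt_of_mem_compl_closure _ h', ← mul_add,
      ← integral_add (integrable_mul_one_div_distPow hs0 hΩ u h')
        (integrable_mul_one_div_distPow hs0 hΩ v h')]
    congr 1
    refine integral_congr_ae ?_
    filter_upwards [Lp.coeFn_add u v] with y hy
    rw [hy, Pi.add_apply, add_mul]

theorem neumannExt_smul (hΩ : MeasurableSet Ω) (c : ℝ) (u : L2 Ω) :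
    neumannExt s Ω (c • u) =ᵐ[volume] c • neumannExt s Ω u := by
  filter_upwards [(ae_restrict_iff' hΩ).1 (Lp.coeFn_smul c u)] with x hx
  rw [Pi.smul_apply, smul_eq_mul]
  by_cases h : x ∈ Ω
  · rw [neumannExt_of_mem _ h, neumannExt_of_mem _ h, hx h, Pi.smul_apply, smul_eq_mul]
  by_cases h' : x ∈ closure Ω
  · rw [neumannExt_of_mem_frontier _ h h', neumannExt_of_mem_frontier _ h h', mul_zero]
  · rw [neumannExt_of_mem_compl_closure _ h', neumannExt_of_mem_compl_closure _ h',
      mul_left_comm c, ← integral_const_mul c]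
    refine congrArg _ (integral_congr_ae ?_)
    filter_upwards [Lp.coeFn_smul c u] with y hy
    rw [hy, Pi.smul_apply, smul_eq_mul, mul_assoc]

theorem neumannExt_sub [IsFiniteMeasure (volume.restrict Ω)] (hs0 : 0 < s) (hΩ : MeasurableSet Ω)
    (u v : L2 Ω) :
    neumannExt s Ω (u - v) =ᵐ[volume] neumannExt s Ω u - neumannExt s Ω v := by
  have huv : u - v = u + (-1 : ℝ) • v := by rw [neg_one_smul, sub_eq_add_neg]
  rw [huv]
  filter_upwards [neumannExt_add hs0 hΩ u ((-1 : ℝ) • v), neumannExt_smul (s := s) hΩ (-1) v]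
    with x h1 h2
  rw [h1, Pi.add_apply, h2, Pi.smul_apply, Pi.sub_apply, smul_eq_mul, neg_one_mul, sub_eq_add_neg]

theorem integrable_neumannExt_sub_div [IsFiniteMeasure (volume.restrict Ω)] (hs0 : 0 < s)
    (hΩ : MeasurableSet Ω) (u : L2 Ω) (hx : x ∈ (closure Ω)ᶜ) :
    IntegrableOn (fun y => (neumannExt s Ω u x - neumannExt s Ω u y) / distPow s x y) Ω := by
  obtain ⟨K, hK⟩ := exists_ae_abs_one_div_distPow_le hs0 hΩ hx
  refine IntegrableOn.congr_fun (integrable_const_sub_mul (Lp.memLp u)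
    (measurable_one_div_distPow s x) hK (neumannExt s Ω u x)) (fun y hy => ?_) hΩ
  rw [neumannExt_of_mem u hy, mul_one_div]

/-- The Neumann extension satisfies the exterior condition. -/
theorem integral_neumannExt_sub_div_eq_zero [IsFiniteMeasure (volume.restrict Ω)] (hs0 : 0 < s)
    (hΩ : MeasurableSet Ω) (u : L2 Ω) (hx : x ∈ (closure Ω)ᶜ) :
    ∫ y in Ω, (neumannExt s Ω u x - neumannExt s Ω u y) / distPow s x y = 0 := by
  obtain ⟨K, hK⟩ := exists_ae_abs_one_div_distPow_le hs0 hΩ hx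
  rw [← integral_weightedMean_sub_mul_eq_zero (Lp.memLp u) (measurable_one_div_distPow s x)
    (one_div_distPow_nonneg s x) hK]
  refine setIntegral_congr_fun hΩ fun y hy => ?_
  simp only [neumannExt_of_mem u hy, neumannExt_of_mem_compl_closure u hx, mul_one_div]

/-- Among all exterior values, those of the Neumann extension minimize the interaction with `Ω`. -/
theorem lintegral_neumannExt_sub_sq_div_le [IsFiniteMeasure (volume.restrict Ω)] (hs0 : 0 < s)
    (hΩ : MeasurableSet Ω) (u : L2 Ω) (hx : x ∈ (closure Ω)ᶜ) (c : ℝ) :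
    ∫⁻ y in Ω, ENNReal.ofReal ((neumannExt s Ω u y - neumannExt s Ω u x) ^ 2 / distPow s y x) ≤
      ∫⁻ y in Ω, ENNReal.ofReal ((neumannExt s Ω u y - c) ^ 2 / distPow s y x) := by
  obtain ⟨K, hK⟩ := exists_ae_abs_one_div_distPow_le hs0 hΩ hx
  have hw := measurable_one_div_distPow (n := n) s x
  have hw0 := one_div_distPow_nonneg (n := n) s x
  have hkey : ∀ b : ℝ,
      ∫⁻ y in Ω, ENNReal.ofReal ((neumannExt s Ω u y - b) ^ 2 / distPow s y x) =
        ENNReal.ofReal (∫ y in Ω, (b - u y) ^ 2 * (1 / distPow s x y)) := by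
    intro b
    rw [ofReal_integral_eq_lintegral_ofReal (integrable_const_sub_sq_mul (Lp.memLp u) hw hK b)
      (ae_of_all _ fun y => mul_nonneg (sq_nonneg _) (hw0 y))]
    refine setLIntegral_congr_fun hΩ fun y hy => ?_
    simp only [neumannExt_of_mem u hy, distPow_comm s y x, mul_one_div, ← neg_sub b, neg_sq]
  rw [hkey, hkey, neumannExt_of_mem_compl_closure u hx]
  exact ENNReal.ofReal_le_ofReal
    (integral_weightedMean_sub_sq_mul_le (Lp.memLp u) hw hw0 hK c)

theorem ae_mem_compl_closure (hnull : volume (frontier Ω) = 0) (hopen : IsOpen Ω) :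
    ∀ᵐ y ∂volume.restrict Ωᶜ, y ∈ (closure Ω)ᶜ := by
  rw [ae_restrict_iff' hopen.measurableSet.compl]
  filter_upwards [measure_eq_zero_iff_ae_notMem.1 hnull] with y hy hyΩ hyc
  rw [hopen.frontier_eq] at hy
  exact hy ⟨hyc, hyΩ⟩

theorem neumannExt_ae_eq_of_ae_eq {f : EuclideanSpace ℝ (Fin n) → ℝ} (hΩ : MeasurableSet Ω)
    (h : u =ᵐ[volume.restrict Ω] f) : ∀ᵐ x, x ∈ Ω → neumannExt s Ω u x = f x := by
  filter_upwards [(ae_restrict_iff' hΩ).1 h] with x hx hxΩ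
  rw [neumannExt_of_mem _ hxΩ, hx hxΩ]

theorem memLp_neumannExt (hΩ : MeasurableSet Ω) (u : L2 Ω) :
    MemLp (neumannExt s Ω u) 2 (volume.restrict Ω) := by
  refine (memLp_congr_ae ?_).1 (Lp.memLp u)
  exact (ae_restrict_iff' hΩ).2 (ae_of_all _ fun x hx => (neumannExt_of_mem u hx).symm)

/-- The energies of `f` and of the extension agree on `Ω × Ω`. On `Ω × Ωᶜ`, integrating over `Ω`
first, the weighted mean does no worse than the value `f y` for almost every exterior `y`. -/
theorem neumannExt_mem_sobolevSpace [IsFiniteMeasure (volume.restrict Ω)] (hs0 : 0 < s)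
    (hopen : IsOpen Ω) (hnull : volume (frontier Ω) = 0) {f : EuclideanSpace ℝ (Fin n) → ℝ}
    (hf : f ∈ sobolevSpace s Ω) (h : u =ᵐ[volume.restrict Ω] f) :
    neumannExt s Ω u ∈ sobolevSpace s Ω := by
  have hΩ := hopen.measurableSet
  have hum : AEMeasurable (neumannExt s Ω u) := (measurable_neumannExt hopen u).aemeasurable
  refine (mem_sobolevSpace_iff hΩ).2 ⟨hum, memLp_neumannExt hΩ u,
    lt_of_le_of_lt ?_ ((mem_sobolevSpace_iff hΩ).1 hf).2.2⟩
  have hae := neumannExt_ae_eq_of_ae_eq (s := s) hΩ h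
  rw [gagliardo_eq, gagliardo_eq]
  refine add_le_add (mul_le_mul_right (le_of_eq ?_) _) ?_
  · refine lintegral_congr_ae ((ae_restrict_iff' (hΩ.prod hΩ)).2 ?_)
    filter_upwards [ae_comp_fst_snd hae] with p hp hpΩ
    rw [fracQuotient, fracQuotient, hp.1 hpΩ.1, hp.2 hpΩ.2]
  · have hmeas : ∀ {g : EuclideanSpace ℝ (Fin n) → ℝ}, AEMeasurable g →
        AEMeasurable (fun p => ENNReal.ofReal (fracQuotient s g p ^ 2))
          ((volume.restrict Ω).prod (volume.restrict Ωᶜ)) := fun hg => by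
      rw [Measure.prod_restrict, ← Measure.volume_eq_prod]
      exact ((aemeasurable_fracQuotient hg).restrict.pow_const 2).ennreal_ofReal
    rw [Measure.volume_eq_prod, ← Measure.prod_restrict, lintegral_prod_symm _ (hmeas hum),
      lintegral_prod_symm _ (hmeas hf.1)]
    refine lintegral_mono_ae ?_
    filter_upwards [ae_mem_compl_closure hnull hopen] with y hy
    simp only [fracQuotient_sq]
    refine (lintegral_neumannExt_sub_sq_div_le hs0 hΩ u hy (f y)).trans_eq ?_
    refine lintegral_congr_ae ((ae_restrict_iff' hΩ).2 ?_)
    filter_upwards [hae] with x hx hxΩ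
    rw [hx hxΩ]

/-- The Neumann extension is orthogonal to the functions which vanish in `Ω`. -/
theorem energy_neumannExt_eq_zero [IsFiniteMeasure (volume.restrict Ω)] (hs0 : 0 < s)
    (hopen : IsOpen Ω) (hnull : volume (frontier Ω) = 0)
    (hu : neumannExt s Ω u ∈ sobolevSpace s Ω) {f : EuclideanSpace ℝ (Fin n) → ℝ}
    (hf : f ∈ sobolevSpace s Ω) (h : ∀ᵐ x, x ∈ Ω → f x = 0) :
    energy s Ω (neumannExt s Ω u) f = 0 := by
  have hΩ := hopen.measurableSet
  have hint := (integrableOn_prod_of_integrable_interactionMeasure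
    (integrable_fracQuotient_mul hΩ hu hf)).2
  simp only [fracQuotient_mul] at hint
  rw [energy]
  have h1 : ∫ x in Ω, ∫ y in Ω, (neumannExt s Ω u x - neumannExt s Ω u y) * (f x - f y) /
      distPow s x y = 0 := by
    refine integral_eq_zero_of_ae ((ae_restrict_iff' hΩ).2 ?_)
    filter_upwards [h] with x hx hxΩ
    refine integral_eq_zero_of_ae ((ae_restrict_iff' hΩ).2 ?_)
    filter_upwards [h] with y hy hyΩ
    simp [hx hxΩ, hy hyΩ]
  have h2 : ∫ x in Ω, ∫ y in Ωᶜ, (neumannExt s Ω u x - neumannExt s Ω u y) * (f x - f y) /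
      distPow s x y = 0 := by
    rw [IntegrableOn, Measure.volume_eq_prod, ← Measure.prod_restrict] at hint
    -- With the exterior point `y` fixed, the integral over `Ω` is `f y` times the one in the
    -- exterior condition.
    rw [integral_integral_swap hint]
    refine integral_eq_zero_of_ae ?_
    filter_upwards [ae_mem_compl_closure hnull hopen] with y hy
    have h3 : ∫ x in Ω, (neumannExt s Ω u x - neumannExt s Ω u y) * (f x - f y) / distPow s x y =
        ∫ x in Ω, f y * ((neumannExt s Ω u y - neumannExt s Ω u x) / distPow s y x) := by
      refine integral_congr_ae ((ae_restrict_iff' hΩ).2 ?_)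
      filter_upwards [h] with x hx hxΩ
      rw [hx hxΩ, distPow_comm s x y]
      ring
    rw [h3, integral_const_mul, integral_neumannExt_sub_div_eq_zero hs0 hΩ u hy, mul_zero]
    rfl
  rw [h1, h2, mul_zero, mul_zero, add_zero]

end NeumannExtension

/-! ### The form `𝔞_N`: closedness, density, weak solutions -/

section NeumannForm

variable {n : ℕ} {s : ℝ} {Ω : Set (EuclideanSpace ℝ (Fin n))}

theorem neumannForm_comm (hΩ : MeasurableSet Ω) :
    IsSymmetricFormOn (neumannFormDomain s Ω) (neumannForm s Ω) :=
  fun _ hu _ hv => energy_comm hΩ hu hv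

theorem neumannForm_self_eq (hΩ : MeasurableSet Ω) {u : L2 Ω} (hu : u ∈ neumannFormDomain s Ω) :
    neumannForm s Ω u u = fracConst n s * (gagliardo s Ω (neumannExt s Ω u)).toReal :=
  energy_self_eq hΩ hu

theorem isNonnegFormOn_neumannForm (hs0 : 0 < s) (hs1 : s < 1) (hΩ : MeasurableSet Ω) :
    IsNonnegFormOn (neumannFormDomain s Ω) (neumannForm s Ω) := fun u hu => by
  rw [neumannForm_self_eq hΩ hu]
  exact mul_nonneg (fracConst_pos hs0 hs1).le ENNReal.toReal_nonneg

theorem mem_neumannFormDomain_iff (hopen : IsOpen Ω) {u : L2 Ω} :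
    u ∈ neumannFormDomain s Ω ↔ gagliardo s Ω (neumannExt s Ω u) < ⊤ := by
  have hΩ := hopen.measurableSet
  refine (mem_sobolevSpace_iff hΩ).trans ⟨fun h => h.2.2, fun h => ?_⟩
  exact ⟨(measurable_neumannExt hopen u).aemeasurable, memLp_neumannExt hΩ u, h⟩

theorem isBilinearFormOn_neumannForm [IsFiniteMeasure (volume.restrict Ω)] (hs0 : 0 < s)
    (hΩ : MeasurableSet Ω) :
    IsBilinearFormOn (neumannFormDomain s Ω) (neumannForm s Ω) := by
  have hadd : ∀ u ∈ neumannFormDomain s Ω, ∀ v ∈ neumannFormDomain s Ω,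
      u + v ∈ neumannFormDomain s Ω := fun u hu v hv =>
    (sobolevSpace_congr hΩ (neumannExt_add hs0 hΩ u v)).2 (add_mem_sobolevSpace hΩ hu hv)
  have hsmul : ∀ c : ℝ, ∀ u ∈ neumannFormDomain s Ω, c • u ∈ neumannFormDomain s Ω :=
    fun c u hu => (sobolevSpace_congr hΩ (neumannExt_smul hΩ c u)).2
      (smul_mem_sobolevSpace hΩ c hu)
  have haddl : ∀ u ∈ neumannFormDomain s Ω, ∀ v ∈ neumannFormDomain s Ω,
      ∀ w ∈ neumannFormDomain s Ω,
      neumannForm s Ω (u + v) w = neumannForm s Ω u w + neumannForm s Ω v w :=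
    fun u hu v hv w hw => (energy_congr_left hΩ (neumannExt_add hs0 hΩ u v) (hadd u hu v hv)
      hw).trans (energy_add_left hΩ hu hv hw)
  have hsmull : ∀ c : ℝ, ∀ u ∈ neumannFormDomain s Ω, ∀ w ∈ neumannFormDomain s Ω,
      neumannForm s Ω (c • u) w = c * neumannForm s Ω u w := fun c u hu w hw =>
    (energy_congr_left hΩ (neumannExt_smul hΩ c u) (hsmul c u hu) hw).trans
      (energy_smul_left hΩ c hu hw)
  have hsym := neumannForm_comm (s := s) hΩ
  refine ⟨?_, hadd, hsmul, haddl, hsmull, fun u hu v hv w hw => ?_, fun c u hu w hw => ?_⟩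
  -- The representative of `0` in `Lp` is zero only almost everywhere; scaling by `0` produces the
  -- honest zero function.
  · have h0 : neumannExt s Ω (0 : L2 Ω) =ᵐ[volume] (0 : ℝ) • neumannExt s Ω (0 : L2 Ω) := by
      simpa using neumannExt_smul (s := s) hΩ 0 (0 : L2 Ω)
    refine (sobolevSpace_congr hΩ h0).2 ((mem_sobolevSpace_iff hΩ).2 ?_)
    rw [zero_smul]
    exact ⟨aemeasurable_const, MemLp.zero', by simp [gagliardo, fracQuotient]⟩
  · rw [hsym w hw _ (hadd u hu v hv), haddl u hu v hv w hw, hsym w hw u hu, hsym w hw v hv]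
  · rw [hsym w hw _ (hsmul c u hu), hsmull c u hu w hw, hsym w hw u hu]

/-- Lower semicontinuity of the Gagliardo seminorm. -/
theorem gagliardo_le_of_tendsto {f : ℕ → EuclideanSpace ℝ (Fin n) → ℝ}
    {g : EuclideanSpace ℝ (Fin n) → ℝ} (hf : ∀ j, AEMeasurable (f j))
    (hlim : ∀ᵐ x, Tendsto (fun j => f j x) atTop (𝓝 (g x))) {c : ENNReal}
    (hc : ∀ᶠ j in atTop, gagliardo s Ω (f j) ≤ c) : gagliardo s Ω g ≤ c := by
  have hac := interactionMeasure_absolutelyContinuous Ω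
  calc gagliardo s Ω g
      = ∫⁻ p, liminf (fun j => ENNReal.ofReal (fracQuotient s (f j) p ^ 2)) atTop
          ∂interactionMeasure Ω := by
        refine lintegral_congr_ae ?_
        filter_upwards [hac (ae_comp_fst_snd hlim)] with p hp
        refine (Tendsto.liminf_eq ?_).symm
        exact (ENNReal.continuous_ofReal.tendsto _).comp
          (((hp.1.sub hp.2).div_const _).pow 2)
    _ ≤ liminf (fun j => gagliardo s Ω (f j)) atTop :=
        lintegral_liminf_le' fun j =>
          (((aemeasurable_fracQuotient (hf j)).mono_ac hac).pow_const 2).ennreal_ofReal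
    _ ≤ c := liminf_le_of_le (by isBoundedDefault) fun b hb => by
        obtain ⟨j, h1, h2⟩ := (hb.and hc).exists
        exact h1.trans h2

/-- The kernel at an exterior point is bounded on `Ω`, hence in `L²(Ω)`, so `u ↦ u_N(x)` is a
continuous functional. -/
theorem tendsto_neumannExt_of_mem_compl_closure [IsFiniteMeasure (volume.restrict Ω)]
    (hs0 : 0 < s) (hΩ : MeasurableSet Ω) {u : ℕ → L2 Ω} {w : L2 Ω}
    (h : Tendsto u atTop (𝓝 w)) {x : EuclideanSpace ℝ (Fin n)} (hx : x ∈ (closure Ω)ᶜ) :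
    Tendsto (fun j => neumannExt s Ω (u j) x) atTop (𝓝 (neumannExt s Ω w x)) := by
  obtain ⟨K, hK⟩ := exists_ae_abs_one_div_distPow_le hs0 hΩ hx
  have hmem : MemLp (fun y => 1 / distPow s x y) 2 (volume.restrict Ω) :=
    (memLp_top_of_bound (measurable_one_div_distPow s x).aestronglyMeasurable K hK).mono_exponent
      le_top
  have hinner : ∀ v : L2 Ω, ∫ y in Ω, v y * (1 / distPow s x y) = inner ℝ hmem.toLp v := by
    intro v
    rw [L2.inner_def]
    refine integral_congr_ae ?_
    filter_upwards [hmem.coeFn_toLp] with y hy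
    rw [hy, RCLike.inner_apply, conj_trivial]
  simp only [neumannExt_of_mem_compl_closure _ hx, hinner]
  exact (tendsto_const_nhds.inner h).const_mul _

theorem exists_subseq_tendsto_neumannExt [IsFiniteMeasure (volume.restrict Ω)] (hs0 : 0 < s)
    (hΩ : MeasurableSet Ω) {u : ℕ → L2 Ω} {w : L2 Ω} (h : Tendsto u atTop (𝓝 w)) :
    ∃ ns : ℕ → ℕ, StrictMono ns ∧
      ∀ᵐ x, Tendsto (fun j => neumannExt s Ω (u (ns j)) x) atTop (𝓝 (neumannExt s Ω w x)) := by
  obtain ⟨ns, hns, hae⟩ := (tendstoInMeasure_of_tendsto_Lp h).exists_seq_tendsto_ae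
  refine ⟨ns, hns, ?_⟩
  filter_upwards [(ae_restrict_iff' hΩ).1 hae] with x hx
  by_cases hxΩ : x ∈ Ω
  · simpa only [neumannExt_of_mem _ hxΩ] using hx hxΩ
  by_cases hxc : x ∈ closure Ω
  · simpa only [neumannExt_of_mem_frontier _ hxΩ hxc] using tendsto_const_nhds
  · exact tendsto_neumannExt_of_mem_compl_closure hs0 hΩ (h.comp hns.tendsto_atTop) hxc

/-- The `L²` limit `w` is the candidate. Along a subsequence the extensions converge almost
everywhere on `ℝⁿ`, and Fatou with `k` fixed bounds the energy of `u k - w`. -/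
theorem isClosedFormOn_neumannForm [IsFiniteMeasure (volume.restrict Ω)] (hs0 : 0 < s)
    (hs1 : s < 1) (hopen : IsOpen Ω) :
    IsClosedFormOn (neumannFormDomain s Ω) (neumannForm s Ω) := by
  intro lam hlam u hu hC
  have hΩ := hopen.measurableSet
  have hb := isBilinearFormOn_neumannForm (s := s) hs0 hΩ
  have hnn := isNonnegFormOn_neumannForm (s := s) hs0 hs1 hΩ
  have hc := fracConst_pos (n := n) hs0 hs1
  have hshift : ∀ v : L2 Ω,
      shiftedForm (neumannForm s Ω) lam v v = neumannForm s Ω v v + lam * ‖v‖ ^ 2 := fun v => by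
    rw [shiftedForm, real_inner_self_eq_norm_sq]
  have hcauchy : CauchySeq u := by
    rw [cauchySeq_iff_tendsto_dist_atTop_0]
    have h1 : Tendsto (fun p : ℕ × ℕ => dist (u p.1) (u p.2) ^ 2) atTop (𝓝 0) := by
      refine squeeze_zero (fun p => sq_nonneg _) (fun p => ?_) (by simpa using hC.div_const lam)
      rw [le_div_iff₀ hlam, hshift, dist_eq_norm]
      linarith [hnn _ (hb.sub_mem (hu p.1) (hu p.2))]
    simpa using h1.sqrt
  obtain ⟨w, hw⟩ := cauchySeq_tendsto_of_complete hcauchy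
  obtain ⟨ns, hns, hlim⟩ := exists_subseq_tendsto_neumannExt (s := s) hs0 hΩ hw
  have hm : ∀ v : L2 Ω, AEMeasurable (neumannExt s Ω v) :=
    fun v => (measurable_neumannExt hopen v).aemeasurable
  -- Stated in `[0, ∞]` because `w` is not yet known to lie in the domain; this bound is what puts
  -- it there.
  have hmain : ∀ ε > 0, ∃ N, ∀ k ≥ N,
      gagliardo s Ω (neumannExt s Ω (u k - w)) ≤ ENNReal.ofReal (ε / fracConst n s) := by
    intro ε hε
    obtain ⟨⟨N₁, N₂⟩, hN⟩ := eventually_atTop.1 (hC.eventually (gt_mem_nhds hε))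
    refine ⟨max N₁ N₂, fun k hk => ?_⟩
    rw [gagliardo_congr (neumannExt_sub hs0 hΩ (u k) w)]
    refine gagliardo_le_of_tendsto
      (f := fun j => neumannExt s Ω (u k) - neumannExt s Ω (u (ns j)))
      (fun j => (hm _).sub (hm _)) ?_ ?_
    · filter_upwards [hlim] with x hx
      exact tendsto_const_nhds.sub hx
    · filter_upwards [eventually_ge_atTop (max N₁ N₂)] with j hj
      have hlt := hN (k, ns j) ⟨(le_max_left _ _).trans hk,
        (le_max_right _ _).trans (hj.trans (hns.le_apply))⟩
      have hmem := hb.sub_mem (hu k) (hu (ns j))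
      rw [hshift, neumannForm_self_eq hΩ hmem] at hlt
      rw [← gagliardo_congr (neumannExt_sub hs0 hΩ (u k) (u (ns j)))]
      refine (ENNReal.le_ofReal_iff_toReal_le ((mem_neumannFormDomain_iff hopen).1 hmem).ne
        (by positivity)).2 ?_
      rw [le_div_iff₀ hc, mul_comm]
      have : 0 ≤ lam * ‖u k - u (ns j)‖ ^ 2 := by positivity
      linarith
  have hsubmem : ∀ k, u k - w ∈ neumannFormDomain s Ω → w ∈ neumannFormDomain s Ω :=
    fun k hk => by simpa using hb.sub_mem (hu k) hk
  have hwD : w ∈ neumannFormDomain s Ω := by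
    obtain ⟨N, hN⟩ := hmain 1 one_pos
    exact hsubmem N ((mem_neumannFormDomain_iff hopen).2
      ((hN N le_rfl).trans_lt ENNReal.ofReal_lt_top))
  refine ⟨w, hwD, ?_⟩
  simp only [hshift]
  have h1 : Tendsto (fun k => neumannForm s Ω (u k - w) (u k - w)) atTop (𝓝 0) := by
    refine Metric.tendsto_atTop.2 fun ε hε => ?_
    -- Fatou yields only a weak inequality; halving `ε` makes it strict.
    obtain ⟨N, hN⟩ := hmain (ε / 2) (by positivity)
    refine ⟨N, fun k hk => ?_⟩
    have hmem := hb.sub_mem (hu k) hwD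
    rw [Real.dist_eq, sub_zero, abs_of_nonneg (hnn _ hmem), neumannForm_self_eq hΩ hmem]
    have h2 := ENNReal.toReal_le_of_le_ofReal (by positivity) (hN k hk)
    rw [le_div_iff₀ hc] at h2
    linarith
  have h2 : Tendsto (fun k => lam * ‖u k - w‖ ^ 2) atTop (𝓝 0) := by
    simpa using ((tendsto_iff_norm_sub_tendsto_zero.1 hw).pow 2).const_mul lam
  simpa using h1.add h2

theorem dense_neumannFormDomain [IsFiniteMeasure (volume.restrict Ω)] (hn : 1 ≤ n) (hs0 : 0 < s)
    (hs1 : s < 1) (hopen : IsOpen Ω) (hnull : volume (frontier Ω) = 0) :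
    Dense (neumannFormDomain s Ω) := by
  refine (Lp.dense_hasCompactSupport_contDiff (F := ℝ) (μ := volume.restrict Ω) (p := 2)
    ENNReal.ofNat_ne_top).mono ?_
  rintro u ⟨g, hug, hg, hgs⟩
  obtain ⟨K, hK⟩ := hgs.lipschitzWith_of_hasCompactSupport hg (by simp)
  obtain ⟨M, hM⟩ := hg.exists_bound_of_continuous hgs.continuous
  refine neumannExt_mem_sobolevSpace hs0 hopen hnull
    (mem_sobolevSpace_of_lipschitz hn hs0 hs1 hopen.measurableSet ?_ hK hM) hug
  rw [← Measure.restrict_apply_univ]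
  exact measure_ne_top _ _

theorem L2_inner_eq_integral (f v : L2 Ω) {g : EuclideanSpace ℝ (Fin n) → ℝ}
    (h : v =ᵐ[volume.restrict Ω] g) : inner ℝ f v = ∫ x in Ω, f x * g x := by
  rw [L2.inner_def]
  refine integral_congr_ae ?_
  filter_upwards [h] with x hx
  rw [hx, RCLike.inner_apply, conj_trivial, mul_comm]

/-- The Neumann extension of `u` is a weak solution if and only if the form identity holds. -/
theorem isWeakNeumannSolution_neumannExt_iff [IsFiniteMeasure (volume.restrict Ω)] (hs0 : 0 < s)
    (hopen : IsOpen Ω) (hnull : volume (frontier Ω) = 0) (u f : L2 Ω) :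
    IsWeakNeumannSolution s Ω f (neumannExt s Ω u) ↔
      u ∈ neumannFormDomain s Ω ∧
        ∀ v ∈ neumannFormDomain s Ω, neumannForm s Ω u v = inner ℝ f v := by
  have hΩ := hopen.measurableSet
  refine and_congr_right fun hu => ⟨fun h v hv => ?_, fun h g hg => ?_⟩
  · rw [neumannForm, h _ hv]
    refine (L2_inner_eq_integral f v ?_).symm
    exact (ae_restrict_iff' hΩ).2 (ae_of_all _ fun x hx => (neumannExt_of_mem v hx).symm)
  · have hgL := ((mem_sobolevSpace_iff hΩ).1 hg).2.1
    have hae := hgL.coeFn_toLp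
    have hv := neumannExt_mem_sobolevSpace hs0 hopen hnull hg hae
    rw [← L2_inner_eq_integral f _ hae, ← h _ hv, neumannForm]
    have hdiff := sub_mem_sobolevSpace hΩ hg hv
    -- A test function `g` is `v_N` plus a remainder vanishing in `Ω`, where `v` is the restriction
    -- of `g`; the remainder does not contribute.
    have h0 := energy_neumannExt_eq_zero hs0 hopen hnull hu hdiff (by
      filter_upwards [neumannExt_ae_eq_of_ae_eq (s := s) hΩ hae] with x hx hxΩ
      rw [Pi.sub_apply, hx hxΩ, sub_self])
    have h1 := energy_add_left hΩ hdiff hv hu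
    rw [sub_add_cancel, energy_comm hΩ hdiff hu, h0, zero_add] at h1
    rw [energy_comm hΩ hu hg, h1, energy_comm hΩ hv hu]

end NeumannForm

end

theorem theorem3p8 (n : ℕ) (hn : 1 ≤ n) (s : ℝ) (hs0 : 0 < s) (hs1 : s < 1)
    (Ω : Set (EuclideanSpace ℝ (Fin n))) (hopen : IsOpen Ω)
    (hbdd : Bornology.IsBounded Ω) (hlip : HasLipschitzBoundary Ω) :
    -- the form is bilinear, symmetric, non-negative, closed and densely defined
    (IsBilinearFormOn (neumannFormDomain s Ω) (neumannForm s Ω) ∧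
      IsSymmetricFormOn (neumannFormDomain s Ω) (neumannForm s Ω) ∧
      IsNonnegFormOn (neumannFormDomain s Ω) (neumannForm s Ω) ∧
      IsClosedFormOn (neumannFormDomain s Ω) (neumannForm s Ω) ∧
      Dense (neumannFormDomain s Ω)) ∧
    -- it has exactly one associated operator
    (∃! A : L2 Ω →ₗ.[ℝ] L2 Ω,
      IsAssociatedOperator (neumannFormDomain s Ω) (neumannForm s Ω) A) ∧
    -- this operator is selfadjoint and is given by the weak solutions of the Neumann problem
    (∀ A : L2 Ω →ₗ.[ℝ] L2 Ω,
      IsAssociatedOperator (neumannFormDomain s Ω) (neumannForm s Ω) A →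
      IsSelfAdjoint A ∧
      (∀ u : L2 Ω, u ∈ A.domain ↔
        neumannExt s Ω u ∈ sobolevSpace s Ω ∧
          ∃ f : L2 Ω, IsWeakNeumannSolution s Ω f (neumannExt s Ω u)) ∧
      (∀ (u : A.domain) (f : L2 Ω),
        A u = f ↔ IsWeakNeumannSolution s Ω f (neumannExt s Ω (u : L2 Ω)))) ∧
    -- the exterior condition holds on the form domain, with a convergent integral
    (∀ u ∈ neumannFormDomain s Ω, ∀ x ∈ (closure Ω)ᶜ,
      IntegrableOn
        (fun y => (neumannExt s Ω u x - neumannExt s Ω u y) / distPow s x y) Ω ∧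
      nonlocalNormalDeriv s Ω (neumannExt s Ω u) x = 0) := by
  have hΩ := hopen.measurableSet
  -- The Lipschitz condition enters only through the null boundary, and boundedness only through the
  -- finite measure of `Ω`.
  have hnull := hlip.volume_frontier hopen
  have : IsFiniteMeasure (volume.restrict Ω) :=
    ⟨by rw [Measure.restrict_apply_univ]; exact hbdd.measure_lt_top⟩
  have hb := isBilinearFormOn_neumannForm (s := s) hs0 hΩ
  have hsym := neumannForm_comm (s := s) hΩ
  have hnn := isNonnegFormOn_neumannForm (s := s) hs0 hs1 hΩ
  have hcl := isClosedFormOn_neumannForm hs0 hs1 hopen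
  have hd := dense_neumannFormDomain hn hs0 hs1 hopen hnull
  have hweak := isWeakNeumannSolution_neumannExt_iff hs0 hopen hnull
  obtain ⟨A₀, hA₀⟩ := hb.exists_associatedOperator hd
  refine ⟨⟨hb, hsym, hnn, hcl, hd⟩,
    ⟨A₀, hA₀, fun B hB => IsBilinearFormOn.associatedOperator_unique hB hA₀⟩,
    fun A hA => ⟨hb.isSelfAdjoint_associatedOperator hsym hnn hcl hA, fun u => ?_, fun u f => ?_⟩,
    fun u _ x hx => ⟨integrable_neumannExt_sub_div hs0 hΩ u hx, ?_⟩⟩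
  · rw [hA.1]
    exact and_congr_right fun hu =>
      exists_congr fun f => ⟨fun h => (hweak u f).2 ⟨hu, h⟩, fun h => ((hweak u f).1 h).2⟩
  · rw [hA.2, hweak]
    exact (and_iff_right ((hA.1 u).1 u.2).1).symm
  · rw [nonlocalNormalDeriv, integral_neumannExt_sub_div_eq_zero hs0 hΩ u hx, mul_zero]
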